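/- Let $G$ be an ample groupoid with compact unit space, that is, a locally compact Hausdorff topological groupoid whose source and range maps $s,r\colon G\to G^{(0)}$ are local homeomorphisms, and whose unit space $G^{(0)}$ is compact and totally disconnected. Let $\mathrm C^*_r(G)$ be its reduced groupoid $\mathrm C^*$-algebra, and let $[[G]]$ be its topological full group, i.e. the group, under multiplication of subsets of $G$, of all compact open subsets $U\subset G$ such that $r|_U$ and $s|_U$ are injective and $r(U)=s(U)=G^{(0)}$. Let $\pi_r\colon [[G]]\to \mathrm C^*_r(G)$, $\pi_r(U)=1_U$, be the canonical unitary representation, and let $\mathrm C^*_{\pi_r}([[G]])$ be the $\mathrm C^*$-subalgebra of $\mathrm C^*_r(G)$ generated by $\pi_r([[G]])$. Say that $\pi_r$ weakly contains the trivial representation if $|\sum_i\alpha_i|\le\|\sum_i\alpha_i\pi_r(U_i)\|$ for every element $\sum_i\alpha_i U_i$ of the group algebra $\mathbb C[[G]]$. Assume that the orbit $G(x)=r(s^{-1}(x))$ has at least three points for each $x\in G^{(0)}$, and consider the following conditions: (i) $\mathrm C^*_r(G)$ admits no tracial state; (ii) $\mathrm C^*_{\pi_r}([[G]])$ admits no character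 (nonzero multiplicative linear functional to $\mathbb C$); (iii) $\pi_r$ does not weakly contain the trivial representation; (iv) $\mathrm C^*_{\pi_r}([[G]])=\mathrm C^*_r(G)$. Then (i) $\Rightarrow$ (ii) $\Leftrightarrow$ (iii) $\Leftrightarrow$ (iv). -/

import Mathlib

open CategoryTheory
open scoped ENNReal CompactlySupported ComplexOrder

universe u v

namespace AmpleGroupoid

/-! ### Ample groupoids

A groupoid is a Mathlib groupoid on a type `X` of objects, which plays the role of the unit space;
the set `G` of its elements is the type of all arrows. The product `g h` in the usual notation for
groupoids is defined if and only if the source of `g` is the range of `h`; in categorical notation it is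
`h ≫ g`. -/

section Arrows

variable (X : Type u) [Groupoid.{v} X]

/-- The set `G` of all elements (arrows) of the groupoid. -/
abbrev Arr : Type max u v := Quiver.Total X

variable {X}

/-- The source map `s : G → G⁽⁰⁾`. -/
def src (g : Arr X) : X := g.left

/-- The range map `r : G → G⁽⁰⁾`. -/
def rng (g : Arr X) : X := g.right

/-- The inclusion of the unit space in the groupoid. -/
def unit (x : X) : Arr X := ⟨x, x, 𝟙 x⟩

/-- The inversion `g ↦ g⁻¹`. -/
noncomputable def inverse (g : Arr X) : Arr X := ⟨g.right, g.left, inv g.hom⟩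

/-- The product `g h` of two elements with `s(g) = r(h)`. -/
def comp (g h : Arr X) (w : src g = rng h) : Arr X :=
  ⟨h.left, g.right, h.hom ≫ eqToHom w.symm ≫ g.hom⟩

/-- The orbit `G(x) = r(s⁻¹(x))` of a unit. -/
def orbit (x : X) : Set X := rng '' (src ⁻¹' {x} : Set (Arr X))

/-- A bisection is a set of arrows on which both the range and the source maps are injective. -/
def IsBisection (U : Set (Arr X)) : Prop := Set.InjOn rng U ∧ Set.InjOn src U

end Arrows

/-- Topological groupoids: all the structure maps are continuous. The unit map is then automatically a
homeomorphism of `X` onto the set of units. -/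
class IsTopologicalGroupoid (X : Type u) [Groupoid.{v} X] [TopologicalSpace X]
    [TopologicalSpace (Arr X)] : Prop where
  continuous_src : Continuous (src : Arr X → X)
  continuous_rng : Continuous (rng : Arr X → X)
  continuous_unit : Continuous (unit : X → Arr X)
  continuous_inverse : Continuous (inverse : Arr X → Arr X)
  continuous_comp : Continuous fun p : {p : Arr X × Arr X // src p.1 = rng p.2} ↦
    comp p.1.1 p.1.2 p.2

/-- Ample groupoids: locally compact, Hausdorff, étale topological groupoids with a totally
disconnected unit space. -/
class IsAmple (X : Type u) [Groupoid.{v} X] [TopologicalSpace X] [TopologicalSpace (Arr X)] : Prop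
    extends IsTopologicalGroupoid X where
  locallyCompact : LocallyCompactSpace (Arr X)
  hausdorff : T2Space (Arr X)
  etale_src : IsLocalHomeomorph (src : Arr X → X)
  etale_rng : IsLocalHomeomorph (rng : Arr X → X)
  totallyDisconnected : TotallyDisconnectedSpace X

/-! ### The left regular representation -/

section Convolution

variable {X : Type u} [Groupoid.{v} X]

/-- The convolution `(f ⋆ ξ)(γ) = ∑_{α β = γ} f(α) ξ(β)`. The pairs `(α, β)` with `α β = γ` are
parametrized by the `α` with `r(α) = r(γ)`, the other factor being `β = α⁻¹ γ`. -/
noncomputable def conv (f ξ : Arr X → ℂ) (γ : Arr X) : ℂ :=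
  ∑' a : Σ z : X, (z ⟶ γ.right), f ⟨a.1, γ.right, a.2⟩ * ξ ⟨γ.left, a.1, γ.hom ≫ inv a.2⟩

/-- The two parametrizations of the composable pairs, `(γ, α)` with `r(α) = r(γ)` and `(β, α)` with
`s(α) = r(β)`, related by `γ = α β`. -/
noncomputable def pairEquiv :
    (Σ γ : Arr X, Σ z : X, (z ⟶ γ.right)) ≃ (Σ β : Arr X, Σ y : X, (β.right ⟶ y)) where
  toFun p := ⟨⟨p.1.left, p.2.1, p.1.hom ≫ inv p.2.2⟩, ⟨p.1.right, p.2.2⟩⟩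
  invFun q := ⟨⟨q.1.left, q.2.1, q.1.hom ≫ q.2.2⟩, ⟨q.1.right, q.2.2⟩⟩
  left_inv := by
    rintro ⟨⟨x, y, g⟩, ⟨z, a⟩⟩
    simp
  right_inv := by
    rintro ⟨⟨x, y, g⟩, ⟨z, a⟩⟩
    simp

theorem finite_fiber {f : Arr X → ℂ} {N : ℕ} (hr : ∀ x, {a | f a ≠ 0 ∧ rng a = x}.encard ≤ N)
    (y : X) : {a : Σ z : X, (z ⟶ y) | f ⟨a.1, y, a.2⟩ ≠ 0}.Finite := by
  refine Set.Finite.of_finite_image (f := fun a ↦ (⟨a.1, y, a.2⟩ : Arr X)) ?_ ?_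
  · refine (Set.finite_of_encard_le_coe (hr y)).subset ?_
    rintro _ ⟨a, ha, rfl⟩
    exact ⟨ha, rfl⟩
  · rintro ⟨z, a⟩ - ⟨z', a'⟩ - h
    simp only [Quiver.Total.mk.injEq] at h
    obtain ⟨rfl, -, h⟩ := h
    simpa using h

theorem card_fiber_rng {f : Arr X → ℂ} {N : ℕ} (hr : ∀ x, {a | f a ≠ 0 ∧ rng a = x}.encard ≤ N)
    (y : X) : {a : Σ z : X, (z ⟶ y) | f ⟨a.1, y, a.2⟩ ≠ 0}.encard ≤ N := by
  refine le_trans ?_ (hr y)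
  rw [← Set.InjOn.encard_image (f := fun a : Σ z : X, (z ⟶ y) ↦ (⟨a.1, y, a.2⟩ : Arr X))]
  · refine Set.encard_le_encard ?_
    rintro _ ⟨a, ha, rfl⟩
    exact ⟨ha, rfl⟩
  · rintro ⟨z, a⟩ - ⟨z', a'⟩ - h
    simp only [Quiver.Total.mk.injEq] at h
    obtain ⟨rfl, -, h⟩ := h
    simpa using h

theorem card_fiber_src {f : Arr X → ℂ} {N : ℕ} (hs : ∀ x, {a | f a ≠ 0 ∧ src a = x}.encard ≤ N)
    (x : X) : {a : Σ y : X, (x ⟶ y) | f ⟨x, a.1, a.2⟩ ≠ 0}.encard ≤ N := by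
  refine le_trans ?_ (hs x)
  rw [← Set.InjOn.encard_image (f := fun a : Σ y : X, (x ⟶ y) ↦ (⟨x, a.1, a.2⟩ : Arr X))]
  · refine Set.encard_le_encard ?_
    rintro _ ⟨a, ha, rfl⟩
    exact ⟨ha, rfl⟩
  · rintro ⟨z, a⟩ - ⟨z', a'⟩ - h
    simp only [Quiver.Total.mk.injEq] at h
    obtain ⟨-, rfl, h⟩ := h
    simpa using h

theorem enorm_conv_sq_le {f : Arr X → ℂ} {N : ℕ} {C : ℝ≥0∞} (hC : ∀ a, ‖f a‖ₑ ≤ C)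
    (hr : ∀ x, {a | f a ≠ 0 ∧ rng a = x}.encard ≤ N) (ξ : Arr X → ℂ) (γ : Arr X) :
    ‖conv f ξ γ‖ₑ ^ 2 ≤ N * C ^ 2 * ∑' a : Σ z : X, (z ⟶ γ.right),
      if f ⟨a.1, γ.right, a.2⟩ ≠ 0 then ‖ξ ⟨γ.left, a.1, γ.hom ≫ inv a.2⟩‖ₑ ^ 2 else 0 := by
  classical
  have hfin := finite_fiber hr γ.right
  have hcard := card_fiber_rng hr γ.right
  set S := hfin.toFinset with hS
  have hScard : (S.card : ℝ≥0∞) ≤ N := by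
    rw [hfin.encard_eq_coe_toFinset_card] at hcard
    exact_mod_cast hcard
  have h1 : conv f ξ γ = ∑ a ∈ S,
      f ⟨a.1, γ.right, a.2⟩ * ξ ⟨γ.left, a.1, γ.hom ≫ inv a.2⟩ := by
    refine tsum_eq_sum fun a ha ↦ ?_
    have : f ⟨a.1, γ.right, a.2⟩ = 0 := by simpa [hS] using ha
    rw [this, zero_mul]
  have h2 : ∑ a ∈ S, ‖ξ ⟨γ.left, a.1, γ.hom ≫ inv a.2⟩‖ₑ ^ 2 ≤ ∑' a : Σ z : X, (z ⟶ γ.right),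
      if f ⟨a.1, γ.right, a.2⟩ ≠ 0 then ‖ξ ⟨γ.left, a.1, γ.hom ≫ inv a.2⟩‖ₑ ^ 2 else 0 := by
    refine le_trans (le_of_eq ?_) (ENNReal.sum_le_tsum S)
    refine Finset.sum_congr rfl fun a ha ↦ ?_
    have : f ⟨a.1, γ.right, a.2⟩ ≠ 0 := by simpa [hS] using ha
    rw [if_pos this]
  have h3 : ‖conv f ξ γ‖ₑ ≤ C * ∑ a ∈ S, ‖ξ ⟨γ.left, a.1, γ.hom ≫ inv a.2⟩‖ₑ := by
    rw [h1, Finset.mul_sum]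
    refine (enorm_sum_le _ _).trans (Finset.sum_le_sum fun a _ ↦ ?_)
    rw [enorm_mul]
    gcongr
    exact hC _
  have h4 : (∑ a ∈ S, ‖ξ ⟨γ.left, a.1, γ.hom ≫ inv a.2⟩‖ₑ) ^ 2
      ≤ S.card * ∑ a ∈ S, ‖ξ ⟨γ.left, a.1, γ.hom ≫ inv a.2⟩‖ₑ ^ 2 := by
    have := sq_sum_le_card_mul_sum_sq (s := S)
      (f := fun a : Σ z : X, (z ⟶ γ.right) ↦ ‖ξ ⟨γ.left, a.1, γ.hom ≫ inv a.2⟩‖₊.toReal)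
    have h' : ((∑ a ∈ S, ‖ξ ⟨γ.left, a.1, γ.hom ≫ inv a.2⟩‖₊) ^ 2 : NNReal)
        ≤ S.card * ∑ a ∈ S, ‖ξ ⟨γ.left, a.1, γ.hom ≫ inv a.2⟩‖₊ ^ 2 := by
      exact_mod_cast this
    have h'' : ((((∑ a ∈ S, ‖ξ ⟨γ.left, a.1, γ.hom ≫ inv a.2⟩‖₊) ^ 2 : NNReal)) : ℝ≥0∞)
        ≤ ((S.card * ∑ a ∈ S, ‖ξ ⟨γ.left, a.1, γ.hom ≫ inv a.2⟩‖₊ ^ 2 : NNReal) : ℝ≥0∞) :=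
      ENNReal.coe_le_coe.2 h'
    push_cast at h''
    exact h''
  calc ‖conv f ξ γ‖ₑ ^ 2 ≤ (C * ∑ a ∈ S, ‖ξ ⟨γ.left, a.1, γ.hom ≫ inv a.2⟩‖ₑ) ^ 2 := by gcongr
    _ = C ^ 2 * (∑ a ∈ S, ‖ξ ⟨γ.left, a.1, γ.hom ≫ inv a.2⟩‖ₑ) ^ 2 := by ring
    _ ≤ C ^ 2 * (S.card * ∑ a ∈ S, ‖ξ ⟨γ.left, a.1, γ.hom ≫ inv a.2⟩‖ₑ ^ 2) := by gcongr
    _ ≤ C ^ 2 * (N * ∑' a : Σ z : X, (z ⟶ γ.right),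
        if f ⟨a.1, γ.right, a.2⟩ ≠ 0 then ‖ξ ⟨γ.left, a.1, γ.hom ≫ inv a.2⟩‖ₑ ^ 2 else 0) := by
      gcongr
    _ = _ := by ring

theorem tsum_conv_sq_le {f : Arr X → ℂ} {N : ℕ} {C : ℝ≥0∞} (hC : ∀ a, ‖f a‖ₑ ≤ C)
    (hr : ∀ x, {a | f a ≠ 0 ∧ rng a = x}.encard ≤ N)
    (hs : ∀ x, {a | f a ≠ 0 ∧ src a = x}.encard ≤ N) (ξ : Arr X → ℂ) :
    ∑' γ, ‖conv f ξ γ‖ₑ ^ 2 ≤ (N * C) ^ 2 * ∑' γ, ‖ξ γ‖ₑ ^ 2 := by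
  classical
  calc ∑' γ, ‖conv f ξ γ‖ₑ ^ 2
      ≤ ∑' γ : Arr X, N * C ^ 2 * ∑' a : Σ z : X, (z ⟶ γ.right),
          if f ⟨a.1, γ.right, a.2⟩ ≠ 0 then ‖ξ ⟨γ.left, a.1, γ.hom ≫ inv a.2⟩‖ₑ ^ 2 else 0 :=
        ENNReal.tsum_le_tsum fun γ ↦ enorm_conv_sq_le hC hr ξ γ
    _ = N * C ^ 2 * ∑' p : Σ γ : Arr X, Σ z : X, (z ⟶ γ.right),
          if f ⟨p.2.1, p.1.right, p.2.2⟩ ≠ 0 then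
            ‖ξ ⟨p.1.left, p.2.1, p.1.hom ≫ inv p.2.2⟩‖ₑ ^ 2 else 0 := by
        rw [ENNReal.tsum_mul_left, ENNReal.tsum_sigma']
    _ = N * C ^ 2 * ∑' q : Σ β : Arr X, Σ y : X, (β.right ⟶ y),
          if f ⟨q.1.right, q.2.1, q.2.2⟩ ≠ 0 then ‖ξ q.1‖ₑ ^ 2 else 0 := by
        rw [← pairEquiv.tsum_eq]
        rfl
    _ = N * C ^ 2 * ∑' β : Arr X, ∑' a : Σ y : X, (β.right ⟶ y),
          if f ⟨β.right, a.1, a.2⟩ ≠ 0 then ‖ξ β‖ₑ ^ 2 else 0 := by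
        rw [ENNReal.tsum_sigma']
    _ ≤ N * C ^ 2 * ∑' β : Arr X, N * ‖ξ β‖ₑ ^ 2 := by
        gcongr with β
        have h := card_fiber_src hs β.right
        have h' : ∑' a : Σ y : X, (β.right ⟶ y),
            (if f ⟨β.right, a.1, a.2⟩ ≠ 0 then ‖ξ β‖ₑ ^ 2 else 0)
            = ∑' a : {a : Σ y : X, (β.right ⟶ y) | f ⟨β.right, a.1, a.2⟩ ≠ 0}, ‖ξ β‖ₑ ^ 2 := by
          rw [tsum_subtype _ (fun _ ↦ ‖ξ β‖ₑ ^ 2)]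
          refine tsum_congr fun a ↦ ?_
          simp [Set.indicator_apply]
        rw [h', ENNReal.tsum_set_const]
        gcongr
        exact_mod_cast h
    _ = (N * C) ^ 2 * ∑' γ, ‖ξ γ‖ₑ ^ 2 := by
        rw [ENNReal.tsum_mul_left]
        ring

theorem conv_add {f : Arr X → ℂ} {N : ℕ} (hr : ∀ x, {a | f a ≠ 0 ∧ rng a = x}.encard ≤ N)
    (ξ η : Arr X → ℂ) : conv f (ξ + η) = conv f ξ + conv f η := by
  funext γ
  have hsum : ∀ ζ : Arr X → ℂ, Summable fun a : Σ z : X, (z ⟶ γ.right) ↦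
      f ⟨a.1, γ.right, a.2⟩ * ζ ⟨γ.left, a.1, γ.hom ≫ inv a.2⟩ := fun ζ ↦ by
    refine summable_of_hasFiniteSupport ((finite_fiber hr γ.right).subset fun a ha ↦ ?_)
    exact left_ne_zero_of_mul ha
  simp only [conv, Pi.add_apply, mul_add]
  exact (hsum ξ).tsum_add (hsum η)

theorem conv_smul (f : Arr X → ℂ) (c : ℂ) (ξ : Arr X → ℂ) :
    conv f (c • ξ) = c • conv f ξ := by
  funext γ
  simp only [conv, Pi.smul_apply, smul_eq_mul, ← tsum_mul_left]
  congr 1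
  funext a
  ring

variable (X) in
/-- The Hilbert space `ℓ²(G)`, which is the orthogonal sum of the spaces `ℓ²(s⁻¹(x))`, `x ∈ G⁽⁰⁾`. -/
abbrev L2 : Type max u v := lp (fun _ : Arr X ↦ ℂ) 2

theorem enorm_L2_sq (ξ : L2 X) : ‖ξ‖ₑ ^ 2 = ∑' γ, ‖ξ γ‖ₑ ^ 2 := by
  have h := lp.norm_rpow_eq_tsum (p := 2) (by norm_num) ξ
  have hs := (lp.memℓp ξ).summable (by norm_num)
  simp only [ENNReal.toReal_ofNat, Real.rpow_ofNat] at h hs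
  have := congrArg ENNReal.ofReal h
  rw [ENNReal.ofReal_tsum_of_nonneg (fun _ ↦ by positivity) hs] at this
  simpa only [ENNReal.ofReal_pow (norm_nonneg _), ofReal_norm] using this

theorem memℓp_conv {f : Arr X → ℂ} {N : ℕ} {C : NNReal} (hC : ∀ a, ‖f a‖ₑ ≤ C)
    (hr : ∀ x, {a | f a ≠ 0 ∧ rng a = x}.encard ≤ N)
    (hs : ∀ x, {a | f a ≠ 0 ∧ src a = x}.encard ≤ N) (ξ : L2 X) :
    Memℓp (E := fun _ : Arr X ↦ ℂ) (conv f ξ) 2 := by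
  refine memℓp_gen ?_
  simp only [ENNReal.toReal_ofNat, Real.rpow_ofNat]
  have h := tsum_conv_sq_le hC hr hs ξ
  rw [← enorm_L2_sq] at h
  have h' : ∑' γ, ‖conv f ξ γ‖ₑ ^ 2 ≠ ⊤ := by
    refine ne_top_of_le_ne_top ?_ h
    have : ‖ξ‖ₑ ≠ ⊤ := enorm_ne_top
    finiteness
  have h2 := ENNReal.summable_toReal h'
  simpa using h2

/-- Convolution by a function which is bounded and has uniformly finite fibers, as a bounded operator
on `ℓ²(G)`. -/
noncomputable def convOp (f : Arr X → ℂ) (N : ℕ) (C : NNReal) (hC : ∀ a, ‖f a‖ₑ ≤ C)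
    (hr : ∀ x, {a | f a ≠ 0 ∧ rng a = x}.encard ≤ N)
    (hs : ∀ x, {a | f a ≠ 0 ∧ src a = x}.encard ≤ N) : L2 X →L[ℂ] L2 X :=
  LinearMap.mkContinuous
    { toFun := fun ξ ↦ ⟨conv f ξ, memℓp_conv hC hr hs ξ⟩
      map_add' := fun ξ η ↦ Subtype.ext (conv_add hr ξ η)
      map_smul' := fun c ξ ↦ Subtype.ext (conv_smul f c ξ) }
    (N * C) (fun ξ ↦ by
      set η : L2 X := ⟨conv f ξ, memℓp_conv hC hr hs ξ⟩ with hη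
      change ‖η‖ ≤ _
      have h := tsum_conv_sq_le hC hr hs ξ
      rw [← enorm_L2_sq] at h
      have h2 : ‖η‖ₑ ^ 2 ≤ (N * C * ‖ξ‖ₑ) ^ 2 := by
        rw [enorm_L2_sq, mul_pow]
        exact h
      have h3 : ‖η‖ₑ ≤ N * C * ‖ξ‖ₑ := by
        rwa [ENNReal.pow_le_pow_left_iff two_ne_zero] at h2
      have h4 : ‖η‖₊ ≤ N * C * ‖ξ‖₊ := by
        rw [← ENNReal.coe_le_coe]
        push_cast
        exact h3
      exact_mod_cast h4)

end Convolution

section Ample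

variable {X : Type u} [Groupoid.{v} X] [TopologicalSpace X] [TopologicalSpace (Arr X)] [IsAmple X]

theorem exists_fiber_bound {K : Set (Arr X)} (hK : IsCompact K) :
    ∃ N : ℕ, (∀ x, {a | a ∈ K ∧ rng a = x}.encard ≤ N) ∧
      (∀ x, {a | a ∈ K ∧ src a = x}.encard ≤ N) := by
  refine hK.induction_on (p := fun K ↦ ∃ N : ℕ, (∀ x, {a | a ∈ K ∧ rng a = x}.encard ≤ N) ∧
      (∀ x, {a | a ∈ K ∧ src a = x}.encard ≤ N)) ?_ ?_ ?_ ?_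
  · exact ⟨0, by simp⟩
  · rintro s t hst ⟨N, h1, h2⟩
    refine ⟨N, fun x ↦ le_trans (Set.encard_le_encard ?_) (h1 x),
      fun x ↦ le_trans (Set.encard_le_encard ?_) (h2 x)⟩
    · rintro a ⟨ha, hx⟩
      exact ⟨hst ha, hx⟩
    · rintro a ⟨ha, hx⟩
      exact ⟨hst ha, hx⟩
  · rintro s t ⟨N, h1, h2⟩ ⟨M, h3, h4⟩
    refine ⟨N + M, fun x ↦ ?_, fun x ↦ ?_⟩
    · have : {a | a ∈ s ∪ t ∧ rng a = x} = {a | a ∈ s ∧ rng a = x} ∪ {a | a ∈ t ∧ rng a = x} := by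
        ext a
        simp only [Set.mem_union, Set.mem_ofPred_eq]
        tauto
      rw [this]
      push_cast
      exact (Set.encard_union_le _ _).trans (add_le_add (h1 x) (h3 x))
    · have : {a | a ∈ s ∪ t ∧ src a = x} = {a | a ∈ s ∧ src a = x} ∪ {a | a ∈ t ∧ src a = x} := by
        ext a
        simp only [Set.mem_union, Set.mem_ofPred_eq]
        tauto
      rw [this]
      push_cast
      exact (Set.encard_union_le _ _).trans (add_le_add (h2 x) (h4 x))
  · rintro a -
    obtain ⟨e, he, hes⟩ := IsAmple.etale_rng (X := X) a
    obtain ⟨e', he', hes'⟩ := IsAmple.etale_src (X := X) a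
    refine ⟨e.source ∩ e'.source, mem_nhdsWithin_of_mem_nhds
      (Filter.inter_mem (e.open_source.mem_nhds he) (e'.open_source.mem_nhds he')), 1, ?_, ?_⟩
    · intro x
      rw [Nat.cast_one, Set.encard_le_one_iff]
      rintro b c ⟨hb, hbx⟩ ⟨hc, hcx⟩
      exact e.injOn hb.1 hc.1 (by rw [← hes]; exact hbx.trans hcx.symm)
    · intro x
      rw [Nat.cast_one, Set.encard_le_one_iff]
      rintro b c ⟨hb, hbx⟩ ⟨hc, hcx⟩
      exact e'.injOn hb.2 hc.2 (by rw [← hes']; exact hbx.trans hcx.symm)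

theorem exists_bounds (f : C_c(Arr X, ℂ)) : ∃ (N : ℕ) (C : NNReal), (∀ a, ‖f a‖ₑ ≤ C) ∧
    (∀ x, {a | f a ≠ 0 ∧ rng a = x}.encard ≤ N) ∧ (∀ x, {a | f a ≠ 0 ∧ src a = x}.encard ≤ N) := by
  obtain ⟨N, h1, h2⟩ := exists_fiber_bound f.hasCompactSupport
  obtain ⟨C, hC⟩ := f.hasCompactSupport.exists_bound_of_continuous f.continuous
  refine ⟨N, C.toNNReal, fun a ↦ ?_, fun x ↦ ?_, fun x ↦ ?_⟩
  · rw [← ofReal_norm, ENNReal.ofReal]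
    exact_mod_cast Real.toNNReal_le_toNNReal (hC a)
  · refine le_trans (Set.encard_le_encard ?_) (h1 x)
    rintro a ⟨ha, hx⟩
    exact ⟨subset_tsupport _ ha, hx⟩
  · refine le_trans (Set.encard_le_encard ?_) (h2 x)
    rintro a ⟨ha, hx⟩
    exact ⟨subset_tsupport _ ha, hx⟩

/-- The left regular representation `λ` of `C_c(G)` on `ℓ²(G)`, the direct sum of the regular
representations on the `ℓ²(s⁻¹(x))`: `λ(f)` is the convolution operator `ξ ↦ f ⋆ ξ`. -/
noncomputable def leftRegular (f : C_c(Arr X, ℂ)) : L2 X →L[ℂ] L2 X :=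
  convOp f (exists_bounds f).choose (exists_bounds f).choose_spec.choose
    (exists_bounds f).choose_spec.choose_spec.1 (exists_bounds f).choose_spec.choose_spec.2.1
    (exists_bounds f).choose_spec.choose_spec.2.2

theorem leftRegular_apply (f : C_c(Arr X, ℂ)) (ξ : L2 X) (γ : Arr X) :
    leftRegular f ξ γ = conv f ξ γ := rfl

variable (X) in
/-- The reduced groupoid C*-algebra `C*_r(G)` of an ample groupoid with compact unit space, as the unital
C*-algebra of operators on `ℓ²(G)` generated by the operators `λ(f)`, `f ∈ C_c(G)`. (These operators
form a *-algebra with unit `λ(1_{G⁽⁰⁾})`, so that `C*_r(G)` is its norm closure.) -/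
noncomputable def reducedCStar : StarSubalgebra ℂ (L2 X →L[ℂ] L2 X) :=
  (StarAlgebra.adjoin ℂ (Set.range (leftRegular (X := X)))).topologicalClosure

instance : IsClosed (reducedCStar X : Set (L2 X →L[ℂ] L2 X)) :=
  StarSubalgebra.isClosed_topologicalClosure _

theorem leftRegular_mem (f : C_c(Arr X, ℂ)) : leftRegular f ∈ reducedCStar X :=
  StarSubalgebra.le_topologicalClosure _ (StarAlgebra.subset_adjoin ℂ _ ⟨f, rfl⟩)

end Ample

/-! ### The topological full group -/

section SetProduct

variable {X : Type u} [Groupoid.{v} X]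

/-- The product of two sets of arrows. -/
def setMul (U V : Set (Arr X)) : Set (Arr X) :=
  {γ | ∃ g ∈ U, ∃ h ∈ V, ∃ w : src g = rng h, comp g h w = γ}

theorem comp_mk {x y z : X} (g : y ⟶ z) (h : x ⟶ y) :
    comp (⟨y, z, g⟩ : Arr X) ⟨x, y, h⟩ rfl = ⟨x, z, h ≫ g⟩ := by
  change (⟨x, z, h ≫ 𝟙 y ≫ g⟩ : Arr X) = _
  rw [Category.id_comp]

theorem mem_setMul {U V : Set (Arr X)} {γ : Arr X} : γ ∈ setMul U V ↔
    ∃ (x y z : X) (g : y ⟶ z) (h : x ⟶ y), (⟨y, z, g⟩ : Arr X) ∈ U ∧ (⟨x, y, h⟩ : Arr X) ∈ V ∧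
      (⟨x, z, h ≫ g⟩ : Arr X) = γ := by
  constructor
  · rintro ⟨⟨y, z, g⟩, hg, ⟨x, y', h⟩, hh, w, rfl⟩
    obtain rfl : y = y' := w
    exact ⟨x, y, z, g, h, hg, hh, (comp_mk g h).symm⟩
  · rintro ⟨x, y, z, g, h, hg, hh, rfl⟩
    exact ⟨_, hg, _, hh, rfl, comp_mk g h⟩

theorem mul_mem_setMul {U V : Set (Arr X)} {x y z : X} {g : y ⟶ z} {h : x ⟶ y}
    (hg : (⟨y, z, g⟩ : Arr X) ∈ U) (hh : (⟨x, y, h⟩ : Arr X) ∈ V) :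
    (⟨x, z, h ≫ g⟩ : Arr X) ∈ setMul U V :=
  mem_setMul.2 ⟨x, y, z, g, h, hg, hh, rfl⟩

theorem inverse_inverse (g : Arr X) : inverse (inverse g) = g := by
  obtain ⟨x, y, g⟩ := g
  simp [inverse]

theorem inverse_injective : Function.Injective (inverse : Arr X → Arr X) :=
  Function.LeftInverse.injective inverse_inverse

theorem image_inverse (U : Set (Arr X)) : inverse '' U = inverse ⁻¹' U :=
  congrFun (Set.image_eq_preimage_of_inverse inverse_inverse inverse_inverse) U

theorem setMul_isBisection {U V : Set (Arr X)} (hU : IsBisection U) (hV : IsBisection V) :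
    IsBisection (setMul U V) := by
  constructor
  · intro γ hγ γ' hγ' e
    obtain ⟨x, y, z, g, h, hg, hh, rfl⟩ := mem_setMul.1 hγ
    obtain ⟨x', y', z', g', h', hg', hh', rfl⟩ := mem_setMul.1 hγ'
    have e1 := hU.1 hg hg' e
    simp only [Quiver.Total.mk.injEq] at e1
    obtain ⟨rfl, rfl, e1⟩ := e1
    obtain rfl := eq_of_heq e1
    have e2 := hV.1 hh hh' rfl
    simp only [Quiver.Total.mk.injEq] at e2
    obtain ⟨rfl, -, e2⟩ := e2
    obtain rfl := eq_of_heq e2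
    rfl
  · intro γ hγ γ' hγ' e
    obtain ⟨x, y, z, g, h, hg, hh, rfl⟩ := mem_setMul.1 hγ
    obtain ⟨x', y', z', g', h', hg', hh', rfl⟩ := mem_setMul.1 hγ'
    have e1 := hV.2 hh hh' e
    simp only [Quiver.Total.mk.injEq] at e1
    obtain ⟨rfl, rfl, e1⟩ := e1
    obtain rfl := eq_of_heq e1
    have e2 := hU.2 hg hg' rfl
    simp only [Quiver.Total.mk.injEq] at e2
    obtain ⟨-, rfl, e2⟩ := e2
    obtain rfl := eq_of_heq e2
    rfl

end SetProduct

section FullGroup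

variable (X : Type u) [Groupoid.{v} X] [TopologicalSpace (Arr X)]

/-- The topological full group `[[G]]`: compact open bisections `U` with `r(U) = s(U) = G⁽⁰⁾`. -/
@[ext]
structure FullGroup where
  /-- the underlying set of arrows -/
  carrier : Set (Arr X)
  isCompact : IsCompact carrier
  isOpen : IsOpen carrier
  isBisection : IsBisection carrier
  rng_image : rng '' carrier = Set.univ
  src_image : src '' carrier = Set.univ

variable {X}

theorem FullGroup.exists_rng (U : FullGroup X) (y : X) :
    ∃ (x : X) (g : x ⟶ y), (⟨x, y, g⟩ : Arr X) ∈ U.carrier := by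
  have : y ∈ rng '' U.carrier := by rw [U.rng_image]; trivial
  obtain ⟨⟨x, y, g⟩, hg, rfl⟩ := this
  exact ⟨x, g, hg⟩

theorem FullGroup.exists_src (U : FullGroup X) (x : X) :
    ∃ (y : X) (g : x ⟶ y), (⟨x, y, g⟩ : Arr X) ∈ U.carrier := by
  have : x ∈ src '' U.carrier := by rw [U.src_image]; trivial
  obtain ⟨⟨x, y, g⟩, hg, rfl⟩ := this
  exact ⟨y, g, hg⟩

theorem FullGroup.eq_of_rng (U : FullGroup X) {x x' y : X} {g : x ⟶ y} {g' : x' ⟶ y}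
    (hg : (⟨x, y, g⟩ : Arr X) ∈ U.carrier) (hg' : (⟨x', y, g'⟩ : Arr X) ∈ U.carrier) :
    (⟨x, y, g⟩ : Arr X) = ⟨x', y, g'⟩ :=
  U.isBisection.1 hg hg' rfl

theorem FullGroup.eq_of_src (U : FullGroup X) {x y y' : X} {g : x ⟶ y} {g' : x ⟶ y'}
    (hg : (⟨x, y, g⟩ : Arr X) ∈ U.carrier) (hg' : (⟨x, y', g'⟩ : Arr X) ∈ U.carrier) :
    (⟨x, y, g⟩ : Arr X) = ⟨x, y', g'⟩ :=
  U.isBisection.2 hg hg' rfl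

variable [TopologicalSpace X] [IsAmple X]

/-- An element of the full group has a continuous section of the source map. -/
theorem FullGroup.exists_section (U : FullGroup X) :
    ∃ σ : X → Arr X, Continuous σ ∧ (∀ x, σ x ∈ U.carrier) ∧ ∀ x, src (σ x) = x := by
  have hle : IsLocalHomeomorph (fun g : U.carrier ↦ src g.1) :=
    (IsAmple.etale_src (X := X)).comp
      (U.isOpen.isOpenEmbedding_subtypeVal).isLocalHomeomorph
  have hinj : Function.Injective (fun g : U.carrier ↦ src g.1) := fun a b h ↦
    Subtype.ext (U.isBisection.2 a.2 b.2 h)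
  have hsurj : Function.Surjective (fun g : U.carrier ↦ src g.1) := fun x ↦ by
    obtain ⟨y, g, hg⟩ := U.exists_src x
    exact ⟨⟨_, hg⟩, rfl⟩
  let e := Equiv.toHomeomorphOfContinuousOpen (Equiv.ofBijective _ ⟨hinj, hsurj⟩)
    hle.continuous hle.isOpenMap
  exact ⟨fun x ↦ (e.symm x).1, continuous_subtype_val.comp e.symm.continuous,
    fun x ↦ (e.symm x).2, fun x ↦ e.apply_symm_apply x⟩

theorem continuous_comp_of {T : Type*} [TopologicalSpace T] {g h : T → Arr X} (hg : Continuous g)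
    (hh : Continuous h) (w : ∀ t, src (g t) = rng (h t)) :
    Continuous fun t ↦ comp (g t) (h t) (w t) :=
  (IsTopologicalGroupoid.continuous_comp (X := X)).comp
    (f := fun t ↦ (⟨(g t, h t), w t⟩ : {p : Arr X × Arr X // src p.1 = rng p.2}))
    ((hg.prodMk hh).subtype_mk _)

theorem FullGroup.isOpen_setMul (U V : FullGroup X) : IsOpen (setMul U.carrier V.carrier) := by
  obtain ⟨σ, hσ, hσV, hσs⟩ := V.exists_section
  have hw : ∀ γ : Arr X, src γ = rng (inverse (σ (src γ))) := fun γ ↦ (hσs (src γ)).symm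
  have hc : Continuous fun γ : Arr X ↦ comp γ (inverse (σ (src γ))) (hw γ) :=
    continuous_comp_of continuous_id ((IsTopologicalGroupoid.continuous_inverse).comp
      (hσ.comp IsTopologicalGroupoid.continuous_src)) hw
  have : setMul U.carrier V.carrier
      = (fun γ : Arr X ↦ comp γ (inverse (σ (src γ))) (hw γ)) ⁻¹' U.carrier := by
    ext γ
    have key : ∀ {x y z : X} (k : x ⟶ z) (h : x ⟶ y) (hh : (⟨x, y, h⟩ : Arr X) ∈ V.carrier),
        comp (⟨x, z, k⟩ : Arr X) (inverse (σ x)) (hw ⟨x, z, k⟩) = ⟨y, z, inv h ≫ k⟩ := by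
      intro x y z k h hh
      have e : σ x = ⟨x, y, h⟩ := V.isBisection.2 (hσV x) hh (hσs x)
      have : ∀ (a : Arr X) (w : src (⟨x, z, k⟩ : Arr X) = rng (inverse a)), a = ⟨x, y, h⟩ →
          comp (⟨x, z, k⟩ : Arr X) (inverse a) w = ⟨y, z, inv h ≫ k⟩ := by
        rintro _ w rfl
        exact comp_mk k (inv h)
      exact this _ _ e
    constructor
    · intro hγ
      obtain ⟨x, y, z, g, h, hg, hh, rfl⟩ := mem_setMul.1 hγ
      change comp (⟨x, z, h ≫ g⟩ : Arr X) (inverse (σ x)) (hw ⟨x, z, h ≫ g⟩) ∈ U.carrier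
      rw [key _ h hh]
      simpa using hg
    · intro hγ
      obtain ⟨x, z, k⟩ := γ
      obtain ⟨y, h, hh⟩ := V.exists_src x
      change comp (⟨x, z, k⟩ : Arr X) (inverse (σ x)) (hw ⟨x, z, k⟩) ∈ U.carrier at hγ
      rw [key k h hh] at hγ
      simpa using mul_mem_setMul hγ hh
  rw [this]
  exact U.isOpen.preimage hc

theorem isOpen_range_unit : IsOpen (Set.range (unit : X → Arr X)) := by
  rw [isOpen_iff_mem_nhds]
  rintro _ ⟨x, rfl⟩
  obtain ⟨e, he, hes⟩ := IsAmple.etale_src (X := X) (unit x)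
  have hc : Continuous fun g : Arr X ↦ unit (src g) :=
    IsTopologicalGroupoid.continuous_unit.comp IsTopologicalGroupoid.continuous_src
  have h1 := e.open_source.mem_nhds he
  have h2 : (fun g : Arr X ↦ unit (src g)) ⁻¹' e.source ∈ nhds (unit x) :=
    hc.continuousAt.preimage_mem_nhds h1
  filter_upwards [h1, h2] with g hg hg'
  refine ⟨src g, e.injOn hg' hg ?_⟩
  rw [← hes]
  rfl

/-- The inverse in the full group is `U⁻¹ = {g⁻¹ : g ∈ U}`. -/
instance : Inv (FullGroup X) where
  inv U :=
    { carrier := inverse '' U.carrier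
      isCompact := U.isCompact.image IsTopologicalGroupoid.continuous_inverse
      isOpen := by
        rw [image_inverse]
        exact U.isOpen.preimage IsTopologicalGroupoid.continuous_inverse
      isBisection := by
        constructor
        · rintro _ ⟨g, hg, rfl⟩ _ ⟨h, hh, rfl⟩ e
          exact congrArg inverse (U.isBisection.2 hg hh e)
        · rintro _ ⟨g, hg, rfl⟩ _ ⟨h, hh, rfl⟩ e
          exact congrArg inverse (U.isBisection.1 hg hh e)
      rng_image := by
        rw [Set.image_image]
        exact U.src_image
      src_image := by
        rw [Set.image_image]
        exact U.rng_image }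

theorem FullGroup.carrier_inv (U : FullGroup X) : U⁻¹.carrier = inverse '' U.carrier := rfl

/-- The characteristic function `1_U` of an element of the full group. -/
noncomputable def charFun (U : FullGroup X) : C_c(Arr X, ℂ) where
  toFun := U.carrier.indicator 1
  continuous_toFun := by
    have : T2Space (Arr X) := IsAmple.hausdorff
    exact continuous_one.indicator (by
      simp [IsClopen.frontier_eq ⟨U.isCompact.isClosed, U.isOpen⟩])
  hasCompactSupport' := by
    have : T2Space (Arr X) := IsAmple.hausdorff
    exact HasCompactSupport.intro U.isCompact fun _ hx ↦ Set.indicator_of_notMem hx _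

theorem leftRegular_charFun_apply (U : FullGroup X) (ξ : L2 X) {x y z : X} (γ : x ⟶ y) (g : z ⟶ y)
    (hg : (⟨z, y, g⟩ : Arr X) ∈ U.carrier) :
    leftRegular (charFun U) ξ ⟨x, y, γ⟩ = ξ ⟨x, z, γ ≫ inv g⟩ := by
  rw [leftRegular_apply, conv, tsum_eq_single (⟨z, g⟩ : Σ z : X, (z ⟶ y))]
  · have : charFun U (⟨z, y, g⟩ : Arr X) = 1 := Set.indicator_of_mem hg _
    change charFun U (⟨z, y, g⟩ : Arr X) * _ = _
    rw [this, one_mul]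
  · rintro ⟨z', g'⟩ hne
    have : charFun U (⟨z', y, g'⟩ : Arr X) = 0 := by
      refine Set.indicator_of_notMem (fun hg' ↦ hne ?_) _
      have e := U.eq_of_rng hg' hg
      simp only [Quiver.Total.mk.injEq] at e
      obtain ⟨rfl, -, e⟩ := e
      obtain rfl := eq_of_heq e
      rfl
    change charFun U (⟨z', y, g'⟩ : Arr X) * _ = 0
    rw [this, zero_mul]

theorem norm_leftRegular_charFun_le (U : FullGroup X) (ξ : L2 X) :
    ‖leftRegular (charFun U) ξ‖ ≤ ‖ξ‖ := by
  have hC : ∀ a, ‖charFun U a‖ₑ ≤ 1 := fun a ↦ by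
    change ‖U.carrier.indicator 1 a‖ₑ ≤ 1
    by_cases ha : a ∈ U.carrier <;> simp [ha]
  have hmem : ∀ {a}, charFun U a ≠ 0 → a ∈ U.carrier := fun {a} h ↦ Set.mem_of_indicator_ne_zero h
  have h := tsum_conv_sq_le (N := 1) (f := charFun U) (C := 1) hC
    (fun x ↦ by
      rw [Nat.cast_one, Set.encard_le_one_iff]
      rintro b c ⟨hb, hbx⟩ ⟨hc, hcx⟩
      exact U.isBisection.1 (hmem hb) (hmem hc) (hbx.trans hcx.symm))
    (fun x ↦ by
      rw [Nat.cast_one, Set.encard_le_one_iff]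
      rintro b c ⟨hb, hbx⟩ ⟨hc, hcx⟩
      exact U.isBisection.2 (hmem hb) (hmem hc) (hbx.trans hcx.symm)) ξ
  rw [← enorm_L2_sq] at h
  have h2 : ‖leftRegular (charFun U) ξ‖ₑ ^ 2 ≤ ‖ξ‖ₑ ^ 2 := by
    rw [enorm_L2_sq]
    simp only [Nat.cast_one, one_mul, one_pow] at h
    exact h
  rw [ENNReal.pow_le_pow_left_iff two_ne_zero] at h2
  exact enorm_le_iff_norm_le.1 h2

variable [CompactSpace X]

theorem FullGroup.isCompact_setMul (U V : FullGroup X) :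
    IsCompact (setMul U.carrier V.carrier) := by
  obtain ⟨σ, hσ, hσU, hσs⟩ := U.exists_section
  obtain ⟨τ, hτ, hτV, hτs⟩ := V.exists_section
  have hw : ∀ x : X, src (σ (rng (τ x))) = rng (τ x) := fun x ↦ hσs _
  have hc : Continuous fun x : X ↦ comp (σ (rng (τ x))) (τ x) (hw x) :=
    continuous_comp_of (hσ.comp (IsTopologicalGroupoid.continuous_rng.comp hτ)) hτ hw
  have : setMul U.carrier V.carrier = Set.range fun x : X ↦ comp (σ (rng (τ x))) (τ x) (hw x) := by
    ext γ
    constructor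
    · rintro ⟨g, hg, h, hh, w, rfl⟩
      have e : τ (src h) = h := V.isBisection.2 (hτV _) hh (hτs _)
      have e' : σ (rng (τ (src h))) = g :=
        U.isBisection.2 (hσU _) hg ((hσs _).trans (by rw [e]; exact w.symm))
      refine ⟨src h, ?_⟩
      have : ∀ (a b : Arr X) (w' : src a = rng b), a = g → b = h → comp a b w' = comp g h w := by
        rintro _ _ _ rfl rfl
        rfl
      exact this _ _ _ e' e
    · rintro ⟨x, rfl⟩
      exact ⟨_, hσU _, _, hτV x, hw x, rfl⟩
  rw [this]
  exact isCompact_range hc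

/-- The product of the full group is the product of sets `U V = {g h : g ∈ U, h ∈ V, s(g) = r(h)}`. -/
instance : Mul (FullGroup X) where
  mul U V :=
    { carrier := setMul U.carrier V.carrier
      isCompact := U.isCompact_setMul V
      isOpen := U.isOpen_setMul V
      isBisection := setMul_isBisection U.isBisection V.isBisection
      rng_image := by
        refine Set.eq_univ_of_forall fun z ↦ ?_
        obtain ⟨y, g, hg⟩ := U.exists_rng z
        obtain ⟨x, h, hh⟩ := V.exists_rng y
        exact ⟨_, mul_mem_setMul hg hh, rfl⟩
      src_image := by
        refine Set.eq_univ_of_forall fun x ↦ ?_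
        obtain ⟨y, h, hh⟩ := V.exists_src x
        obtain ⟨z, g, hg⟩ := U.exists_src y
        exact ⟨_, mul_mem_setMul hg hh, rfl⟩ }

/-- The neutral element of the full group is the unit space. -/
instance : One (FullGroup X) where
  one :=
    { carrier := Set.range unit
      isCompact := isCompact_range IsTopologicalGroupoid.continuous_unit
      isOpen := isOpen_range_unit
      isBisection := by
        constructor
        · rintro _ ⟨x, rfl⟩ _ ⟨y, rfl⟩ h
          exact congrArg unit h
        · rintro _ ⟨x, rfl⟩ _ ⟨y, rfl⟩ h
          exact congrArg unit h
      rng_image := Set.eq_univ_of_forall fun x ↦ ⟨_, ⟨x, rfl⟩, rfl⟩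
      src_image := Set.eq_univ_of_forall fun x ↦ ⟨_, ⟨x, rfl⟩, rfl⟩ }

theorem FullGroup.carrier_mul (U V : FullGroup X) :
    (U * V).carrier = setMul U.carrier V.carrier := rfl

theorem FullGroup.carrier_one : (1 : FullGroup X).carrier = Set.range unit := rfl

/-- The full group is a group. -/
instance : Group (FullGroup X) :=
  Group.ofLeftAxioms
    (by
      intro U V W
      ext γ
      simp only [FullGroup.carrier_mul]
      constructor
      · intro h
        obtain ⟨x, y, z, g, h, hg, hh, rfl⟩ := mem_setMul.1 h
        obtain ⟨y, t, z, k, l, hk, hl, e⟩ := mem_setMul.1 hg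
        simp only [Quiver.Total.mk.injEq] at e
        obtain ⟨rfl, rfl, e⟩ := e
        obtain rfl := eq_of_heq e
        rw [← Category.assoc]
        exact mul_mem_setMul hk (mul_mem_setMul hl hh)
      · intro h
        obtain ⟨x, y, z, g, h, hg, hh, rfl⟩ := mem_setMul.1 h
        obtain ⟨x, t, y, k, l, hk, hl, e⟩ := mem_setMul.1 hh
        simp only [Quiver.Total.mk.injEq] at e
        obtain ⟨rfl, rfl, e⟩ := e
        obtain rfl := eq_of_heq e
        rw [Category.assoc]
        exact mul_mem_setMul (mul_mem_setMul hg hk) hl)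
    (by
      intro U
      ext γ
      simp only [FullGroup.carrier_mul, FullGroup.carrier_one]
      constructor
      · intro h
        obtain ⟨x, y, z, g, h, ⟨t, hg⟩, hh, rfl⟩ := mem_setMul.1 h
        simp only [unit, Quiver.Total.mk.injEq] at hg
        obtain ⟨rfl, rfl, e⟩ := hg
        obtain rfl := eq_of_heq e
        simpa using hh
      · intro h
        obtain ⟨x, y, g⟩ := γ
        have := mul_mem_setMul (U := Set.range unit) (g := 𝟙 y) ⟨y, rfl⟩ h
        simpa using this)
    (by
      intro U
      ext γ
      simp only [FullGroup.carrier_mul, FullGroup.carrier_one, FullGroup.carrier_inv]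
      constructor
      · intro h
        obtain ⟨x, y, z, g, h, ⟨⟨a, b, k⟩, hk, hg⟩, hh, rfl⟩ := mem_setMul.1 h
        simp only [inverse, Quiver.Total.mk.injEq] at hg
        obtain ⟨rfl, rfl, e⟩ := hg
        obtain rfl := eq_of_heq e
        have e := U.eq_of_rng hk hh
        simp only [Quiver.Total.mk.injEq] at e
        obtain ⟨rfl, -, e⟩ := e
        obtain rfl := eq_of_heq e
        exact ⟨a, by simp [unit]⟩
      · rintro ⟨x, rfl⟩
        obtain ⟨y, g, hg⟩ := U.exists_src x
        have := mul_mem_setMul (U := inverse '' U.carrier) (g := inv g)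
          ⟨_, hg, rfl⟩ hg
        simpa [unit] using this)

/-! ### The unitary representation of the full group -/

theorem leftRegular_charFun_one : leftRegular (charFun (1 : FullGroup X)) = 1 := by
  ext ξ ⟨x, y, γ⟩
  rw [leftRegular_charFun_apply 1 ξ γ (𝟙 y) (Set.mem_range_self y)]
  simp

theorem leftRegular_charFun_mul (U V : FullGroup X) :
    leftRegular (charFun (U * V)) = leftRegular (charFun U) * leftRegular (charFun V) := by
  ext ξ ⟨x, y, γ⟩
  obtain ⟨z, g, hg⟩ := U.exists_rng y
  obtain ⟨w, h, hh⟩ := V.exists_rng z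
  rw [leftRegular_charFun_apply (U * V) ξ γ (h ≫ g) (mul_mem_setMul hg hh),
    mul_apply_eq_comp, leftRegular_charFun_apply U _ γ g hg,
    leftRegular_charFun_apply V ξ (γ ≫ inv g) h hh]
  simp

theorem leftRegular_charFun_mem_unitary (U : FullGroup X) :
    leftRegular (charFun U) ∈ unitary (L2 X →L[ℂ] L2 X) := by
  have h1 : leftRegular (charFun U⁻¹) * leftRegular (charFun U) = 1 := by
    rw [← leftRegular_charFun_mul, inv_mul_cancel, leftRegular_charFun_one]
  have h2 : leftRegular (charFun U) * leftRegular (charFun U⁻¹) = 1 := by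
    rw [← leftRegular_charFun_mul, mul_inv_cancel, leftRegular_charFun_one]
  have hnorm : ∀ ξ : L2 X, ‖leftRegular (charFun U) ξ‖ = ‖ξ‖ := fun ξ ↦ by
    refine le_antisymm (norm_leftRegular_charFun_le U ξ) ?_
    calc ‖ξ‖ = ‖leftRegular (charFun U⁻¹) (leftRegular (charFun U) ξ)‖ := by
          rw [← mul_apply_eq_comp, h1, one_apply_eq_self]
      _ ≤ _ := norm_leftRegular_charFun_le U⁻¹ _
  have h3 : star (leftRegular (charFun U)) * leftRegular (charFun U) = 1 :=
    (ContinuousLinearMap.norm_map_iff_adjoint_comp_self _).1 hnorm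
  have h4 : star (leftRegular (charFun U)) = leftRegular (charFun U⁻¹) := by
    calc star (leftRegular (charFun U))
        = star (leftRegular (charFun U)) * (leftRegular (charFun U) * leftRegular (charFun U⁻¹)) := by
          rw [h2, mul_one]
      _ = _ := by rw [← mul_assoc, h3, one_mul]
  exact Unitary.mem_iff.2 ⟨h3, by rw [h4, h2]⟩

variable (X) in
/-- The canonical unitary representation `π_r` of `[[G]]` in `C*_r(G)`, `U ↦ 1_U`. -/
noncomputable def piR : FullGroup X →* unitary (reducedCStar X) where
  toFun U := ⟨⟨leftRegular (charFun U), leftRegular_mem _⟩, by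
    have h := Unitary.mem_iff.1 (leftRegular_charFun_mem_unitary U)
    exact Unitary.mem_iff.2 ⟨Subtype.ext h.1, Subtype.ext h.2⟩⟩
  map_one' := Subtype.ext (Subtype.ext leftRegular_charFun_one)
  map_mul' U V := Subtype.ext (Subtype.ext (leftRegular_charFun_mul U V))

end FullGroup

/-! ### Notions for C*-algebras and unitary representations -/

/-- The unital C*-algebra `A` has a tracial state: a positive linear functional `τ` with `τ(1) = 1` and
`τ(a b) = τ(b a)`. -/
def HasTracialState (A : Type*) [CStarAlgebra A] : Prop :=
  ∃ τ : A →ₗ[ℂ] ℂ, (∀ a, 0 ≤ τ (star a * a)) ∧ τ 1 = 1 ∧ ∀ a b, τ (a * b) = τ (b * a)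

/-- The C*-algebra `A` has a character: a nonzero multiplicative linear functional. -/
def HasCharacter (A : Type*) [CStarAlgebra A] : Prop :=
  Nonempty (WeakDual.characterSpace ℂ A)

/-- The C*-algebra `C*_η(Γ)` generated by the range of a unitary representation `η` in a unital
C*-algebra. -/
noncomputable def repCStar {Γ A : Type*} [Group Γ] [CStarAlgebra A] (η : Γ →* unitary A) :
    StarSubalgebra ℂ A :=
  (StarAlgebra.adjoin ℂ (Set.range fun g ↦ (η g : A))).topologicalClosure

instance {Γ A : Type*} [Group Γ] [CStarAlgebra A] (η : Γ →* unitary A) :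
    IsClosed (repCStar η : Set A) :=
  StarSubalgebra.isClosed_topologicalClosure _

/-- Weak containment: `σ` weakly contains `η` if `‖∑ αᵢ η(gᵢ)‖ ≤ ‖∑ αᵢ σ(gᵢ)‖` for every element
`∑ αᵢ gᵢ` of the group algebra `ℂΓ`. -/
def WeaklyContains {Γ A B : Type*} [Group Γ] [CStarAlgebra A] [CStarAlgebra B]
    (σ : Γ →* unitary A) (η : Γ →* unitary B) : Prop :=
  ∀ α : Γ →₀ ℂ, ‖α.sum fun g c ↦ c • (η g : B)‖ ≤ ‖α.sum fun g c ↦ c • (σ g : A)‖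

/-- The trivial representation `g ↦ 1` of a group in `ℂ`. -/
def trivialRep (Γ : Type*) [Group Γ] : Γ →* unitary ℂ := 1

end AmpleGroupoid

namespace AmpleGroupoid

/-! ### Clopen sets and compact open bisections -/

/-! Write `v` for `1_V` with `V` in the full group and `p_K` for the projection of a clopen set `K`
of units. Everything is compared with one property, `HasAlmostInvariantVectors`: for every finite
`F` and `ε > 0` some unit vector of `ℓ²(G)` is moved by less than `ε` by each `V` in `F`. It is
equivalent to weak containment of the trivial representation.

If the property fails, some Laplacian `Δ = ∑ (v - 1)* (v - 1)` over a finite set is bounded below,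
hence invertible, and its inverse lies in the algebra generated by the full group. The heart of the
proof is that `(v - 1) p_K (w - 1)*` always lies in this algebra (`sub_one_mul_proj_mul_mem`), hence
so do `Δ p_K Δ` and `p_K = Δ⁻¹ (Δ p_K Δ) Δ⁻¹`. The full group and the `p_K` generate `C*_r(G)`
(`starSubalgebra_eq_top`), so the two algebras coincide. For the membership, let `K`, `V(K)`, `W(K)`
be pairwise disjoint and put `a = (v - 1) p_K`, `b = (w - 1) p_K`. Then `a* b = p_K`, so `a b* = (a
a*)(b b*)`, and `a a*` is `1` minus the involution of the full group exchanging `K` and `V(K)`. The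
general case is reduced to this one locally, using a third point in each orbit.

If the algebras coincide, there is no character: it would vanish on `p_K` whenever `K` is moved off
itself, and such sets generate all clopen sets, so it would vanish on `1`.

If the property holds, a limit of vector states along an ultrafilter is multiplicative on the
algebra of the full group, which gives a character. Composed with the diagonal part of operators,
the same limit is a tracial state of `C*_r(G)`. -/

/-- In a compact space, a property of clopen sets which is stable under disjoint unions and holds locally
holds for all clopen sets. -/
theorem isClopen_induction {T : Type*} [TopologicalSpace T] [CompactSpace T] {P : Set T → Prop}
    (hempty : P ∅)
    (hunion : ∀ K L, IsClopen K → IsClopen L → Disjoint K L → P K → P L → P (K ∪ L))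
    (hlocal : ∀ x, ∃ K, IsClopen K ∧ x ∈ K ∧ ∀ L, IsClopen L → L ⊆ K → P L)
    {K : Set T} (hK : IsClopen K) : P K := by
  obtain ⟨L, -, hL, hPL⟩ : ∃ L : Set T, IsClopen L ∧ Set.univ ⊆ L ∧
      ∀ K, IsClopen K → K ⊆ L → P K := by
    -- The induction runs on a hereditary property: `s` lies in a clopen set all of whose clopen
    -- subsets satisfy `P`. Heredity lets the union step cut `K` into the disjoint pieces `K ∩ L`
    -- and `K \ L`.
    refine isCompact_univ.induction_on (p := fun s ↦ ∃ L : Set T, IsClopen L ∧ s ⊆ L ∧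
      ∀ K, IsClopen K → K ⊆ L → P K) ?_ ?_ ?_ ?_
    · exact ⟨∅, isClopen_empty, subset_rfl, fun K _ h ↦ by
        rwa [Set.subset_empty_iff.1 h]⟩
    · rintro s t hst ⟨L, h1, h2, h3⟩
      exact ⟨L, h1, hst.trans h2, h3⟩
    · rintro s t ⟨L, h1, h2, h3⟩ ⟨L', h1', h2', h3'⟩
      refine ⟨L ∪ L', h1.union h1', Set.union_subset_union h2 h2', fun K hK h ↦ ?_⟩
      rw [← Set.inter_union_sdiff K L]
      refine hunion _ _ (hK.inter h1) (hK.diff h1) ?_ (h3 _ (hK.inter h1) Set.inter_subset_right)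
        (h3' _ (hK.diff h1) ?_)
      · exact Set.disjoint_left.2 fun x hx hx' ↦ hx'.2 hx.2
      · rintro x ⟨hx, hx'⟩
        exact (h hx).resolve_left hx'
    · rintro x -
      obtain ⟨L, h1, h2, h3⟩ := hlocal x
      exact ⟨L, mem_nhdsWithin_of_mem_nhds (h1.isOpen.mem_nhds h2), L, h1, subset_rfl, h3⟩
  exact hPL K hK ((Set.subset_univ K).trans hL)

/-! ### Third points of orbits, and the action of the full group on sets of units -/

section Action

theorem exists_hom_notMem_pair {X : Type u} [Groupoid.{v} X] (horbit : ∀ x : X, 3 ≤ (orbit x).encard) (x y : X) :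
    ∃ z, z ≠ x ∧ z ≠ y ∧ Nonempty (x ⟶ z) := by
  by_contra! h
  have hsub : orbit x ⊆ {x, y} := by
    rintro _ ⟨⟨x', z, g⟩, rfl, rfl⟩
    by_contra hz
    simp only [Set.mem_insert_iff, Set.mem_singleton_iff, not_or] at hz
    exact (h z hz.1 hz.2).false g
  have h3 := (horbit x).trans ((Set.encard_le_encard hsub).trans (Set.encard_insert_le {y} x))
  rw [Set.encard_singleton] at h3
  exact absurd h3 (by decide)

variable {X : Type u} [Groupoid.{v} X] [TopologicalSpace (Arr X)]

namespace FullGroup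

/-- The action of the full group on subsets of the unit space. -/
def image (V : FullGroup X) (K : Set X) : Set X := rng '' (V.carrier ∩ src ⁻¹' K)

theorem mem_image_iff {V : FullGroup X} {K : Set X} {x y : X} {g : x ⟶ y}
    (hg : (⟨x, y, g⟩ : Arr X) ∈ V.carrier) : y ∈ V.image K ↔ x ∈ K := by
  constructor
  · rintro ⟨a, ⟨haV, haK⟩, hay⟩
    rwa [V.isBisection.1 haV hg hay] at haK
  · exact fun hx ↦ ⟨_, ⟨hg, hx⟩, rfl⟩

theorem image_mono (V : FullGroup X) {K L : Set X} (h : K ⊆ L) : V.image K ⊆ V.image L :=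
  Set.image_mono (Set.inter_subset_inter_right _ (Set.preimage_mono h))

end FullGroup

end Action

/-! ### Compact open bisections and existence of full group elements -/

section Topology

variable {X : Type u} [Groupoid.{v} X] [TopologicalSpace X] [TopologicalSpace (Arr X)] [IsAmple X]

variable (X) in
theorem t2Space_unitSpace : T2Space X :=
  have : T2Space (Arr X) := IsAmple.hausdorff
  T2Space.of_injective_continuous (f := (unit : X → Arr X))
    (fun _ _ h ↦ congrArg src h) IsTopologicalGroupoid.continuous_unit

variable (X) in
theorem continuous_src : Continuous (src : Arr X → X) := IsTopologicalGroupoid.continuous_src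

variable (X) in
theorem continuous_rng : Continuous (rng : Arr X → X) := IsTopologicalGroupoid.continuous_rng

theorem FullGroup.isClopen_image (V : FullGroup X) {K : Set X} (hK : IsClopen K) : IsClopen (V.image K) := by
  have := t2Space_unitSpace X
  constructor
  · exact ((V.isCompact.inter_right (hK.isClosed.preimage (continuous_src X))).image
      (continuous_rng X)).isClosed
  · exact (IsAmple.etale_rng (X := X)).isOpenMap _
      (V.isOpen.inter (hK.isOpen.preimage (continuous_src X)))

variable [CompactSpace X]

theorem exists_isClopen_subset {O : Set X} (hO : IsOpen O) {x : X} (hx : x ∈ O) :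
    ∃ K, IsClopen K ∧ x ∈ K ∧ K ⊆ O :=
  have := t2Space_unitSpace X
  have : TotallyDisconnectedSpace X := IsAmple.totallyDisconnected
  compact_exists_isClopen_in_isOpen hO hx

/-- Compact open bisections form a basis of the topology of an ample groupoid. -/
theorem exists_bisection_subset {W : Set (Arr X)} (hW : IsOpen W) {g : Arr X} (hg : g ∈ W) :
    ∃ U ⊆ W, g ∈ U ∧ IsCompact U ∧ IsOpen U ∧ IsBisection U := by
  obtain ⟨e, he, hes⟩ := IsAmple.etale_src (X := X) g
  obtain ⟨e', he', hes'⟩ := IsAmple.etale_rng (X := X) g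
  -- A local inverse of the source map over a small clopen neighbourhood of `src g` has a compact
  -- open image. It is taken inside the source chart, the range chart and `W`, so that it is a
  -- bisection contained in `W`.
  have hO : IsOpen (e '' (e.source ∩ (W ∩ e'.source))) :=
    e.isOpen_image_source_inter (hW.inter e'.open_source)
  obtain ⟨K, hK, hgK, hKO⟩ := exists_isClopen_subset hO ⟨g, ⟨he, hg, he'⟩, rfl⟩
  have hKt : K ⊆ e.target := by
    intro x hx
    obtain ⟨a, ha, rfl⟩ := hKO hx
    exact e.map_source ha.1
  have hsub : e.symm '' K ⊆ e.source ∩ (W ∩ e'.source) := by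
    rintro _ ⟨x, hx, rfl⟩
    obtain ⟨a, ha, rfl⟩ := hKO hx
    rwa [e.left_inv ha.1]
  refine ⟨e.symm '' K, fun a ha ↦ (hsub ha).2.1, ⟨_, hgK, e.left_inv he⟩, ?_, ?_, ?_, ?_⟩
  · exact hK.isClosed.isCompact.image_of_continuousOn (e.continuousOn_symm.mono hKt)
  · exact e.symm.isOpen_image_of_subset_source hK.isOpen hKt
  · intro a ha b hb hab
    refine e'.injOn (hsub ha).2.2 (hsub hb).2.2 ?_
    rwa [← hes']
  · intro a ha b hb hab
    refine e.injOn (hsub ha).1 (hsub hb).1 ?_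
    rwa [← hes]

namespace FullGroup

/-- The involution in the full group which exchanges the source and the range of a compact open
bisection `U` with disjoint source and range. -/
def swap (U : Set (Arr X)) (hc : IsCompact U) (ho : IsOpen U) (hb : IsBisection U)
    (hd : Disjoint (src '' U) (rng '' U)) : FullGroup X where
  carrier := U ∪ inverse '' U ∪ unit '' (src '' U ∪ rng '' U)ᶜ
  isCompact := by
    refine (hc.union (hc.image IsTopologicalGroupoid.continuous_inverse)).union
      (IsCompact.image (IsClosed.isCompact ?_) IsTopologicalGroupoid.continuous_unit)
    exact (((IsAmple.etale_src (X := X)).isOpenMap _ ho).union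
      ((IsAmple.etale_rng (X := X)).isOpenMap _ ho)).isClosed_compl
  isOpen := by
    have := t2Space_unitSpace X
    refine (ho.union ?_).union ?_
    · rw [image_inverse]
      exact ho.preimage IsTopologicalGroupoid.continuous_inverse
    · have h1 : IsOpen (src '' U ∪ rng '' U)ᶜ :=
        ((hc.image (continuous_src X)).isClosed.union
          (hc.image (continuous_rng X)).isClosed).isOpen_compl
      have h2 : unit '' (src '' U ∪ rng '' U)ᶜ
          = Set.range unit ∩ src ⁻¹' (src '' U ∪ rng '' U)ᶜ := by
        ext g
        constructor
        · rintro ⟨x, hx, rfl⟩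
          exact ⟨⟨x, rfl⟩, hx⟩
        · rintro ⟨⟨x, rfl⟩, hx⟩
          exact ⟨x, hx, rfl⟩
      rw [h2]
      exact isOpen_range_unit.inter (h1.preimage (continuous_src X))
  isBisection := by
    have hd' : ∀ a ∈ U, ∀ b ∈ U, src a ≠ rng b := fun a ha b hb h ↦
      Set.disjoint_left.1 hd ⟨a, ha, rfl⟩ ⟨b, hb, h.symm⟩
    have hsrc : ∀ a ∈ U, src a ∈ src '' U ∪ rng '' U := fun a ha ↦ .inl ⟨a, ha, rfl⟩
    have hrng : ∀ a ∈ U, rng a ∈ src '' U ∪ rng '' U := fun a ha ↦ .inr ⟨a, ha, rfl⟩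
    constructor
    · rintro _ ((ha | ⟨a, ha, rfl⟩) | ⟨x, hx, rfl⟩) _ ((hb' | ⟨b, hb', rfl⟩) | ⟨y, hy, rfl⟩) h
      · exact hb.1 ha hb' h
      · exact (hd' _ hb' _ ha h.symm).elim
      · exact (hy ((show rng _ = y from h) ▸ hrng _ ha)).elim
      · exact (hd' _ ha _ hb' h).elim
      · exact congrArg inverse (hb.2 ha hb' h)
      · exact (hy ((show src a = y from h) ▸ hsrc _ ha)).elim
      · exact (hx ((show x = rng _ from h) ▸ hrng _ hb')).elim
      · exact (hx ((show x = src b from h) ▸ hsrc _ hb')).elim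
      · exact congrArg unit h
    · rintro _ ((ha | ⟨a, ha, rfl⟩) | ⟨x, hx, rfl⟩) _ ((hb' | ⟨b, hb', rfl⟩) | ⟨y, hy, rfl⟩) h
      · exact hb.2 ha hb' h
      · exact (hd' _ ha _ hb' h).elim
      · exact (hy ((show src _ = y from h) ▸ hsrc _ ha)).elim
      · exact (hd' _ hb' _ ha h.symm).elim
      · exact congrArg inverse (hb.1 ha hb' h)
      · exact (hy ((show rng a = y from h) ▸ hrng _ ha)).elim
      · exact (hx ((show x = src _ from h) ▸ hsrc _ hb')).elim
      · exact (hx ((show x = rng b from h) ▸ hrng _ hb')).elim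
      · exact congrArg unit h
  rng_image := by
    refine Set.eq_univ_of_forall fun x ↦ ?_
    by_cases hx : x ∈ src '' U ∪ rng '' U
    · obtain ⟨a, ha, rfl⟩ | ⟨a, ha, rfl⟩ := hx
      · exact ⟨inverse a, .inl (.inr ⟨a, ha, rfl⟩), rfl⟩
      · exact ⟨a, .inl (.inl ha), rfl⟩
    · exact ⟨unit x, .inr ⟨x, hx, rfl⟩, rfl⟩
  src_image := by
    refine Set.eq_univ_of_forall fun x ↦ ?_
    by_cases hx : x ∈ src '' U ∪ rng '' U
    · obtain ⟨a, ha, rfl⟩ | ⟨a, ha, rfl⟩ := hx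
      · exact ⟨a, .inl (.inl ha), rfl⟩
      · exact ⟨inverse a, .inl (.inr ⟨a, ha, rfl⟩), rfl⟩
    · exact ⟨unit x, .inr ⟨x, hx, rfl⟩, rfl⟩

/-- Separating `x` from `y` gives a bisection around `g` with disjoint source and range, which
`swap` completes to an element of the full group. -/
theorem exists_mem_of_ne {x y : X} (g : x ⟶ y) (hxy : x ≠ y) :
    ∃ V : FullGroup X, (⟨x, y, g⟩ : Arr X) ∈ V.carrier := by
  have := t2Space_unitSpace X
  obtain ⟨O, O', hO, hO', hx, hy, hd⟩ := t2_separation hxy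
  obtain ⟨U, hUW, hgU, hc, ho, hb⟩ := exists_bisection_subset (g := (⟨x, y, g⟩ : Arr X))
    ((hO.preimage (continuous_src X)).inter (hO'.preimage (continuous_rng X))) ⟨hx, hy⟩
  refine ⟨swap U hc ho hb (hd.mono ?_ ?_), .inl (.inl hgU)⟩
  · rintro _ ⟨a, ha, rfl⟩
    exact (hUW ha).1
  · rintro _ ⟨a, ha, rfl⟩
    exact (hUW ha).2

/-- If all the orbits have at least three points, then every arrow is in an element of the full group. -/
theorem exists_mem (horbit : ∀ x : X, 3 ≤ (orbit x).encard) (a : Arr X) :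
    ∃ V : FullGroup X, a ∈ V.carrier := by
  obtain ⟨x, y, g⟩ := a
  -- The arrow may be isotropy, for which `swap` is of no use. Factoring it through a third point
  -- `z` leaves two arrows with distinct ends.
  obtain ⟨z, hzx, hzy, ⟨h⟩⟩ := exists_hom_notMem_pair horbit x y
  obtain ⟨V, hV⟩ := exists_mem_of_ne h hzx.symm
  obtain ⟨W, hW⟩ := exists_mem_of_ne (inv h ≫ g) hzy
  refine ⟨W * V, ?_⟩
  rw [carrier_mul]
  simpa using mul_mem_setMul hW hV

/-- Sufficiently small neighbourhoods of a point are moved into a given neighbourhood of its image. -/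
theorem exists_image_subset (V : FullGroup X) {x y : X} {g : x ⟶ y}
    (hg : (⟨x, y, g⟩ : Arr X) ∈ V.carrier) {O : Set X} (hO : IsOpen O) (hy : y ∈ O) :
    ∃ K, IsClopen K ∧ x ∈ K ∧ V.image K ⊆ O := by
  -- Since the source map is open, the points that `V` sends into `O` form an open set.
  have ho : IsOpen (src '' (V.carrier ∩ rng ⁻¹' O)) := (IsAmple.etale_src (X := X)).isOpenMap _
      (V.isOpen.inter (hO.preimage (continuous_rng X)))
  obtain ⟨K, hK, hxK, hKO⟩ := exists_isClopen_subset ho ⟨_, ⟨hg, hy⟩, rfl⟩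
  refine ⟨K, hK, hxK, ?_⟩
  rintro _ ⟨a, ⟨haV, haK⟩, rfl⟩
  obtain ⟨b, ⟨hbV, hbO⟩, hab⟩ := hKO haK
  rwa [← V.isBisection.2 hbV haV hab]

theorem exists_disjoint_image (V : FullGroup X) {x y : X} {g : x ⟶ y}
    (hg : (⟨x, y, g⟩ : Arr X) ∈ V.carrier) (hxy : x ≠ y) :
    ∃ K, IsClopen K ∧ x ∈ K ∧ Disjoint K (V.image K) := by
  have := t2Space_unitSpace X
  obtain ⟨O, O', hO, hO', hx, hy, hd⟩ := t2_separation hxy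
  obtain ⟨K, hK, hxK, hKO⟩ := V.exists_image_subset hg hO' hy
  obtain ⟨L, hL, hxL, hLO⟩ := exists_isClopen_subset hO hx
  refine ⟨K ∩ L, hK.inter hL, ⟨hxK, hxL⟩, hd.mono (Set.inter_subset_right.trans hLO) ?_⟩
  exact (V.image_mono Set.inter_subset_left).trans hKO

theorem exists_disjoint_image_image (V W : FullGroup X) {x y z : X} {g : x ⟶ y} {h : x ⟶ z}
    (hg : (⟨x, y, g⟩ : Arr X) ∈ V.carrier) (hh : (⟨x, z, h⟩ : Arr X) ∈ W.carrier) (hyz : y ≠ z) :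
    ∃ K, IsClopen K ∧ x ∈ K ∧ Disjoint (V.image K) (W.image K) := by
  have := t2Space_unitSpace X
  obtain ⟨O, O', hO, hO', hy, hz, hd⟩ := t2_separation hyz
  obtain ⟨K, hK, hxK, hKO⟩ := V.exists_image_subset hg hO hy
  obtain ⟨L, hL, hxL, hLO⟩ := W.exists_image_subset hh hO' hz
  refine ⟨K ∩ L, hK.inter hL, ⟨hxK, hxL⟩, hd.mono ?_ ?_⟩
  · exact (V.image_mono Set.inter_subset_left).trans hKO
  · exact (W.image_mono Set.inter_subset_right).trans hLO

end FullGroup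

end Topology

/-- Used with `v = 1_V`, `w = 1_{V⁻¹}`, and `p`, `q` the projections of `K` and `V(K)`. -/
theorem sub_one_mul_mul_sub_one {R : Type*} [Ring R] (v w p q : R) (hp : p * p = p)
    (hq : v * p * w = q) : (v - 1) * p * (p * (w - 1)) = q + p - v * p - p * w := by
  calc (v - 1) * p * (p * (w - 1)) = (v - 1) * (p * p) * (w - 1) := by noncomm_ring
    _ = v * p * w + p - v * p - p * w := by
      rw [hp]
      noncomm_ring
    _ = _ := by rw [hq]

/-! ### Unitaries and projections in the reduced C*-algebra -/

section Multiplication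

variable {X : Type u} [Groupoid.{v} X] [TopologicalSpace X] [TopologicalSpace (Arr X)] [IsAmple X]

theorem leftRegular_add (f g : C_c(Arr X, ℂ)) :
    leftRegular (f + g) = leftRegular f + leftRegular g := by
  ext ξ γ
  have hsum : ∀ f : C_c(Arr X, ℂ), Summable fun a : Σ z : X, (z ⟶ γ.right) ↦
      f ⟨a.1, γ.right, a.2⟩ * ξ ⟨γ.left, a.1, γ.hom ≫ inv a.2⟩ := fun f ↦ by
    obtain ⟨N, C, -, hr, -⟩ := exists_bounds f
    refine summable_of_hasFiniteSupport ((finite_fiber hr γ.right).subset fun a ha ↦ ?_)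
    exact left_ne_zero_of_mul ha
  change conv (f + g) ξ γ = conv f ξ γ + conv g ξ γ
  refine Eq.trans (tsum_congr fun a ↦ ?_) ((hsum f).tsum_add (hsum g))
  exact add_mul _ _ _

theorem leftRegular_eq_zero {f : C_c(Arr X, ℂ)} (hf : ∀ a, f a = 0) : leftRegular f = 0 := by
  ext ξ γ
  change conv f ξ γ = 0
  simp [conv, hf]

theorem reducedCStar_ext {a b : reducedCStar X}
    (h : ∀ (ξ : L2 X) (γ : Arr X), a.1 ξ γ = b.1 ξ γ) : a = b :=
  Subtype.ext (ContinuousLinearMap.ext fun ξ ↦ lp.ext (funext (h ξ)))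

theorem reducedCStar_mul_apply (a b : reducedCStar X) (ξ : L2 X) :
    (a * b).1 ξ = a.1 (b.1 ξ) := rfl

theorem reducedCStar_add_apply (a b : reducedCStar X) (ξ : L2 X) (γ : Arr X) :
    (a + b).1 ξ γ = a.1 ξ γ + b.1 ξ γ := rfl

theorem reducedCStar_one_apply (ξ : L2 X) (γ : Arr X) :
    (1 : reducedCStar X).1 ξ γ = ξ γ := rfl

variable [CompactSpace X]

/-- A continuous function on the unit space, as a function on the groupoid supported on the units. -/
noncomputable def unitFun (h : C(X, ℂ)) : C_c(Arr X, ℂ) where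
  toFun := (Set.range unit).indicator fun γ ↦ h (src γ)
  continuous_toFun := by
    have : T2Space (Arr X) := IsAmple.hausdorff
    exact (h.continuous.comp (continuous_src X)).indicator (by
      simp [IsClopen.frontier_eq
        ⟨(isCompact_range (IsTopologicalGroupoid.continuous_unit (X := X))).isClosed,
          isOpen_range_unit⟩])
  hasCompactSupport' := by
    have : T2Space (Arr X) := IsAmple.hausdorff
    exact HasCompactSupport.intro
      (isCompact_range (IsTopologicalGroupoid.continuous_unit (X := X)))
      fun _ hx ↦ Set.indicator_of_notMem hx _

theorem unitFun_unit (h : C(X, ℂ)) (x : X) : unitFun h ⟨x, x, 𝟙 x⟩ = h x :=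
  Set.indicator_of_mem (s := Set.range (unit : X → Arr X)) (a := ⟨x, x, 𝟙 x⟩) ⟨x, rfl⟩
    fun γ ↦ h (src γ)

theorem leftRegular_unitFun_apply (h : C(X, ℂ)) (ξ : L2 X) (γ : Arr X) :
    leftRegular (unitFun h) ξ γ = h (rng γ) * ξ γ := by
  obtain ⟨x, y, γ⟩ := γ
  rw [leftRegular_apply, conv, tsum_eq_single (⟨y, 𝟙 y⟩ : Σ z : X, (z ⟶ y))]
  · change unitFun h (⟨y, y, 𝟙 y⟩ : Arr X) * ξ ⟨x, y, γ ≫ inv (𝟙 y)⟩ = h y * _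
    rw [unitFun_unit]
    simp
  · rintro ⟨z, g⟩ hne
    have : unitFun h (⟨z, y, g⟩ : Arr X) = 0 := by
      refine Set.indicator_of_notMem (s := Set.range (unit : X → Arr X)) (a := ⟨z, y, g⟩) ?_
        fun γ ↦ h (src γ)
      rintro ⟨w, hw⟩
      simp only [unit, Quiver.Total.mk.injEq] at hw
      obtain ⟨rfl, rfl, e⟩ := hw
      obtain rfl := eq_of_heq e
      exact hne rfl
    change unitFun h (⟨z, y, g⟩ : Arr X) * _ = 0
    rw [this, zero_mul]

theorem star_leftRegular_unitFun (h : C(X, ℂ)) :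
    star (leftRegular (unitFun h)) = leftRegular (unitFun (star h)) := by
  symm
  refine (ContinuousLinearMap.eq_adjoint_iff _ _).2 fun ξ η ↦ ?_
  rw [lp.inner_eq_tsum, lp.inner_eq_tsum]
  refine tsum_congr fun γ ↦ ?_
  rw [leftRegular_unitFun_apply, leftRegular_unitFun_apply]
  simp only [RCLike.inner_apply, ContinuousMap.star_apply, map_mul, RCLike.star_def,
    Complex.conj_conj]
  ring

/-- Continuous functions on the unit space as elements of the reduced C*-algebra. -/
noncomputable def mulOp : C(X, ℂ) →⋆ₐ[ℂ] reducedCStar X where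
  toFun h := ⟨leftRegular (unitFun h), leftRegular_mem _⟩
  map_one' := reducedCStar_ext fun ξ γ ↦ by
    refine (leftRegular_unitFun_apply _ _ _).trans ?_
    simp
  map_mul' h k := reducedCStar_ext fun ξ γ ↦ by
    refine (leftRegular_unitFun_apply _ _ _).trans ?_
    refine Eq.trans ?_ (leftRegular_unitFun_apply h (leftRegular (unitFun k) ξ) γ).symm
    rw [leftRegular_unitFun_apply]
    simp [mul_assoc]
  map_zero' := reducedCStar_ext fun ξ γ ↦ by
    refine (leftRegular_unitFun_apply _ _ _).trans ?_
    simp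
  map_add' h k := reducedCStar_ext fun ξ γ ↦ by
    refine (leftRegular_unitFun_apply _ _ _).trans ?_
    refine Eq.trans ?_ (congrArg₂ (· + ·) (leftRegular_unitFun_apply h ξ γ).symm
      (leftRegular_unitFun_apply k ξ γ).symm)
    simp [add_mul]
  commutes' c := reducedCStar_ext fun ξ γ ↦ by
    refine (leftRegular_unitFun_apply _ _ _).trans ?_
    simp [Algebra.algebraMap_eq_smul_one]
  map_star' h := Subtype.ext (star_leftRegular_unitFun h).symm

theorem mulOp_apply (h : C(X, ℂ)) (ξ : L2 X) (γ : Arr X) :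
    (mulOp h : reducedCStar X).1 ξ γ = h (rng γ) * ξ γ :=
  leftRegular_unitFun_apply h ξ γ

/-- The operator `1_V` as an element of the reduced C*-algebra. -/
noncomputable def fullOp (V : FullGroup X) : reducedCStar X := piR X V

theorem fullOp_apply (V : FullGroup X) (ξ : L2 X) {x y z : X} (γ : x ⟶ y) (g : z ⟶ y)
    (hg : (⟨z, y, g⟩ : Arr X) ∈ V.carrier) :
    (fullOp V).1 ξ ⟨x, y, γ⟩ = ξ ⟨x, z, γ ≫ inv g⟩ :=
  leftRegular_charFun_apply V ξ γ g hg

theorem fullOp_mul (V W : FullGroup X) : fullOp (V * W) = fullOp V * fullOp W :=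
  congrArg Subtype.val (map_mul (piR X) V W)

theorem fullOp_one : fullOp (1 : FullGroup X) = 1 :=
  congrArg Subtype.val (map_one (piR X))

theorem star_fullOp (V : FullGroup X) : star (fullOp V) = fullOp V⁻¹ :=
  (congrArg Subtype.val (map_inv (piR X) V)).symm

theorem fullOp_mul_inv (V : FullGroup X) : fullOp V * fullOp V⁻¹ = 1 := by
  rw [← fullOp_mul, mul_inv_cancel, fullOp_one]

theorem fullOp_inv_mul (V : FullGroup X) : fullOp V⁻¹ * fullOp V = 1 := by
  rw [← fullOp_mul, inv_mul_cancel, fullOp_one]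

open Classical in
/-- The characteristic function of a clopen set of units (and `0` for sets which are not clopen), as an
element of the reduced C*-algebra. -/
noncomputable def proj (K : Set X) : reducedCStar X :=
  if hK : IsClopen K then mulOp ⟨K.indicator 1, continuous_one.indicator (by
    simp [hK.frontier_eq])⟩ else 0

theorem proj_apply {K : Set X} (hK : IsClopen K) (ξ : L2 X) (γ : Arr X) :
    (proj K).1 ξ γ = K.indicator 1 (rng γ) * ξ γ := by
  rw [proj, dif_pos hK, mulOp_apply]
  rfl

theorem proj_mul_proj {K L : Set X} (hK : IsClopen K) (hL : IsClopen L) :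
    proj K * proj L = proj (K ∩ L) := by
  refine reducedCStar_ext fun ξ γ ↦ ?_
  rw [reducedCStar_mul_apply, proj_apply hK, proj_apply hL, proj_apply (hK.inter hL)]
  by_cases h1 : rng γ ∈ K <;> by_cases h2 : rng γ ∈ L <;> simp [h1, h2]

theorem proj_empty : proj (∅ : Set X) = 0 := by
  refine reducedCStar_ext fun ξ γ ↦ (proj_apply isClopen_empty _ _).trans ?_
  simp

theorem proj_univ : proj (Set.univ : Set X) = 1 := by
  refine reducedCStar_ext fun ξ γ ↦ (proj_apply isClopen_univ _ _).trans ?_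
  simp

theorem proj_union {K L : Set X} (hK : IsClopen K) (hL : IsClopen L) (h : Disjoint K L) :
    proj (K ∪ L) = proj K + proj L := by
  refine reducedCStar_ext fun ξ γ ↦ (proj_apply (hK.union hL) _ _).trans ?_
  refine Eq.trans ?_ (congrArg₂ (· + ·) (proj_apply hK ξ γ) (proj_apply hL ξ γ)).symm
  rw [Set.indicator_union_of_disjoint h]
  exact add_mul _ _ _

theorem star_proj (K : Set X) : star (proj K) = proj K := by
  unfold proj
  split_ifs with hK
  · rw [← map_star]
    congr 1
    ext x
    by_cases hx : x ∈ K <;> simp [hx]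
  · exact star_zero _

theorem proj_mul_self {K : Set X} (hK : IsClopen K) : proj K * proj K = proj K := by
  rw [proj_mul_proj hK hK, Set.inter_self]

theorem proj_mul_proj_of_disjoint {K L : Set X} (hK : IsClopen K) (hL : IsClopen L)
    (h : Disjoint K L) : proj K * proj L = 0 := by
  rw [proj_mul_proj hK hL, h.inter_eq, proj_empty]

/-- The covariance relation. It turns disjointness of `K` and its images into vanishing of products.
-/
theorem fullOp_mul_proj (V : FullGroup X) {K : Set X} (hK : IsClopen K) :
    fullOp V * proj K = proj (V.image K) * fullOp V := by
  refine reducedCStar_ext fun ξ ⟨x, y, γ⟩ ↦ ?_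
  obtain ⟨z, g, hg⟩ := V.exists_rng y
  rw [reducedCStar_mul_apply, reducedCStar_mul_apply, fullOp_apply V _ γ g hg,
    proj_apply (V.isClopen_image hK), proj_apply hK, fullOp_apply V _ γ g hg]
  congr 1
  change K.indicator 1 z = (V.image K).indicator 1 y
  by_cases h : z ∈ K
  · simp [h, (FullGroup.mem_image_iff hg).2 h]
  · simp [h, mt (FullGroup.mem_image_iff hg).1 h]

/-- The element `(1_V - 1) 1_K`. -/
noncomputable def diffOn (V : FullGroup X) (K : Set X) : reducedCStar X :=
  (fullOp V - 1) * proj K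

/-- If `V` moves `K` off itself, then the involution exchanging `K` and its image by `V` is in the
full group. -/
theorem exists_swap (V : FullGroup X) {K : Set X} (hK : IsClopen K) (hd : Disjoint K (V.image K)) :
    ∃ W : FullGroup X, 1 - fullOp W = diffOn V K * star (diffOn V K) := by
  have := t2Space_unitSpace X
  set U : Set (Arr X) := V.carrier ∩ src ⁻¹' K with hU
  have hVK := V.isClopen_image hK
  have hsU : src '' U = K := by
    refine Set.Subset.antisymm (by rintro _ ⟨a, ha, rfl⟩; exact ha.2) fun x hx ↦ ?_
    obtain ⟨y, g, hg⟩ := V.exists_src x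
    exact ⟨_, ⟨hg, hx⟩, rfl⟩
  have hrU : rng '' U = V.image K := rfl
  have hc : IsCompact U := V.isCompact.inter_right (hK.isClosed.preimage (continuous_src X))
  have ho : IsOpen U := V.isOpen.inter (hK.isOpen.preimage (continuous_src X))
  have hb : IsBisection U :=
    ⟨V.isBisection.1.mono Set.inter_subset_left, V.isBisection.2.mono Set.inter_subset_left⟩
  have hd' : Disjoint (src '' U) (rng '' U) := by rwa [hsU, hrU]
  set W := FullGroup.swap U hc ho hb hd' with hW
  refine ⟨W, ?_⟩
  have hexp : diffOn V K * star (diffOn V K) = proj (V.image K) + proj K - fullOp V * proj K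
      - proj K * fullOp V⁻¹ := by
    have h1 : fullOp V * proj K * fullOp V⁻¹ = proj (V.image K) := by
      rw [fullOp_mul_proj V hK, mul_assoc, fullOp_mul_inv, mul_one]
    rw [diffOn, star_mul, star_sub, star_one, star_proj, star_fullOp]
    exact sub_one_mul_mul_sub_one _ _ _ _ (proj_mul_self hK) h1
  -- The subtractions are moved across, so that both sides can be evaluated at an arrow using only
  -- sums and products.
  suffices h : fullOp W + (proj (V.image K) + proj K) =
      1 + (fullOp V * proj K + proj K * fullOp V⁻¹) by
    rw [hexp, sub_eq_iff_eq_add]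
    rw [← eq_sub_iff_add_eq] at h
    rw [h]
    abel
  refine reducedCStar_ext fun ξ ⟨x, y, γ⟩ ↦ ?_
  simp only [reducedCStar_add_apply, reducedCStar_mul_apply, reducedCStar_one_apply]
  obtain ⟨z, g, hg⟩ := V.exists_rng y
  obtain ⟨w, k, hk⟩ := V.exists_src y
  have hki : (⟨w, y, inv k⟩ : Arr X) ∈ V⁻¹.carrier := ⟨_, hk, rfl⟩
  rw [proj_apply hVK, proj_apply hK, fullOp_apply V _ γ g hg, proj_apply hK, proj_apply hK,
    fullOp_apply V⁻¹ _ γ (inv k) hki]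
  change _ + ((V.image K).indicator 1 y * _ + K.indicator 1 y * _)
    = _ + (K.indicator 1 z * _ + K.indicator 1 y * _)
  -- The arrow of `W` with range `y` comes from `V⁻¹` if `y ∈ K`, from `V` if `y ∈ V(K)`, and is a
  -- unit otherwise.
  by_cases hy : y ∈ K
  · have hyV : y ∉ V.image K := Set.disjoint_left.1 hd hy
    have hz : z ∉ K := mt (FullGroup.mem_image_iff hg).2 hyV
    rw [fullOp_apply W ξ γ (inv k) (.inl (.inr ⟨_, ⟨hk, hy⟩, rfl⟩))]
    simp only [Set.indicator_of_mem hy, Set.indicator_of_notMem hyV, Set.indicator_of_notMem hz,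
      Pi.one_apply]
    ring
  · by_cases hz : z ∈ K
    · have hyV : y ∈ V.image K := (FullGroup.mem_image_iff hg).2 hz
      rw [fullOp_apply W ξ γ g (.inl (.inl ⟨hg, hz⟩))]
      simp only [Set.indicator_of_notMem hy, Set.indicator_of_mem hyV, Set.indicator_of_mem hz,
        Pi.one_apply]
      ring
    · have hyV : y ∉ V.image K := mt (FullGroup.mem_image_iff hg).1 hz
      rw [fullOp_apply W ξ γ (𝟙 y) (.inr ⟨y, by rw [hsU, hrU]; exact fun h ↦ h.elim hy hyV, rfl⟩)]
      simp only [Set.indicator_of_notMem hy, Set.indicator_of_notMem hyV,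
        Set.indicator_of_notMem hz]
      simp

end Multiplication

/-! ### Generators of the reduced C*-algebra -/

section Generation

variable {X : Type u} [Groupoid.{v} X] [TopologicalSpace X] [TopologicalSpace (Arr X)] [IsAmple X]

/-- The operator `λ(f)` as an element of the reduced C*-algebra. -/
noncomputable def regular (f : C_c(Arr X, ℂ)) : reducedCStar X := ⟨leftRegular f, leftRegular_mem f⟩

theorem regular_add (f g : C_c(Arr X, ℂ)) : regular (f + g) = regular f + regular g :=
  Subtype.ext (leftRegular_add f g)

theorem regular_eq_zero {f : C_c(Arr X, ℂ)} (hf : ∀ a, f a = 0) : regular f = 0 :=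
  Subtype.ext (leftRegular_eq_zero hf)

variable [CompactSpace X]

/-- A function supported on an element `V` of the full group is the product of a function on the unit
space and of the characteristic function of `V`. -/
theorem regular_eq_mulOp_mul_fullOp {f : C_c(Arr X, ℂ)} {V : FullGroup X}
    (hf : ∀ a, f a ≠ 0 → a ∈ V.carrier) : ∃ h : C(X, ℂ), regular f = mulOp h * fullOp V := by
  -- Inverting a source section of `V⁻¹` gives a range section of `V`: `inverse (σ x)` is the arrow
  -- of `V` with range `x`, and `h x` is the value of `f` there.
  obtain ⟨σ, hσ, hσV, hσs⟩ := V⁻¹.exists_section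
  have hσV' : ∀ x, inverse (σ x) ∈ V.carrier := fun x ↦ by
    obtain ⟨a, ha, hax⟩ := hσV x
    rwa [← hax, inverse_inverse]
  refine ⟨⟨fun x ↦ f (inverse (σ x)),
    f.continuous.comp (IsTopologicalGroupoid.continuous_inverse.comp hσ)⟩, ?_⟩
  refine reducedCStar_ext fun ξ ⟨x, y, γ⟩ ↦ ?_
  obtain ⟨z, g, hg⟩ := V.exists_rng y
  rw [reducedCStar_mul_apply, mulOp_apply, fullOp_apply V ξ γ g hg]
  change leftRegular f ξ ⟨x, y, γ⟩ = f (inverse (σ y)) * _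
  have hy : inverse (σ y) = ⟨z, y, g⟩ := V.isBisection.1 (hσV' y) hg (hσs y)
  rw [hy, leftRegular_apply, conv, tsum_eq_single (⟨z, g⟩ : Σ z : X, (z ⟶ y))]
  rintro ⟨z', g'⟩ hne
  have : f (⟨z', y, g'⟩ : Arr X) = 0 := by
    by_contra h
    have e := V.eq_of_rng (hf _ h) hg
    simp only [Quiver.Total.mk.injEq] at e
    obtain ⟨rfl, -, e⟩ := e
    obtain rfl := eq_of_heq e
    exact hne rfl
  change f (⟨z', y, g'⟩ : Arr X) * _ = 0
  rw [this, zero_mul]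

/-- Stone–Weierstrass: the preimage of `S` in `C(X)` is a closed star subalgebra, and it contains
the characteristic functions of clopen sets, which separate points. -/
theorem mulOp_mem {S : StarSubalgebra ℂ (reducedCStar X)} (hcl : IsClosed (S : Set (reducedCStar X)))
    (hK : ∀ K : Set X, IsClopen K → proj K ∈ S) (h : C(X, ℂ)) : mulOp h ∈ S := by
  have hcont : Continuous (mulOp (X := X)) :=
    AddMonoidHomClass.continuous_of_bound _ 1 fun h ↦ by
      rw [one_mul]
      exact NonUnitalStarAlgHom.norm_apply_le _ h
  have htop : S.comap mulOp = ⊤ := by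
    have h1 : IsClosed (S.comap (mulOp (X := X)) : Set C(X, ℂ)) := hcl.preimage hcont
    rw [← ContinuousMap.starSubalgebra_topologicalClosure_eq_top_of_separatesPoints
      (S.comap (mulOp (X := X)))]
    · exact SetLike.coe_injective (by
        rw [StarSubalgebra.topologicalClosure_coe, h1.closure_eq])
    · intro x y hxy
      have := t2Space_unitSpace X
      obtain ⟨K, hKc, hx, hy⟩ := exists_isClopen_subset (isOpen_compl_singleton (x := y)) hxy
      have hyK : y ∉ K := fun h ↦ hy h rfl
      refine ⟨K.indicator 1, ⟨⟨K.indicator 1, continuous_one.indicator (by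
        simp [hKc.frontier_eq])⟩, ?_, rfl⟩, ?_⟩
      · have := hK K hKc
        rwa [proj, dif_pos hKc] at this
      · simp [hx, hyK]
  have : h ∈ S.comap mulOp := htop ▸ trivial
  exact this

/-- The reduced C*-algebra is generated by the full group and the clopen sets of units. -/
theorem starSubalgebra_eq_top (horbit : ∀ x : X, 3 ≤ (orbit x).encard)
    {S : StarSubalgebra ℂ (reducedCStar X)} (hcl : IsClosed (S : Set (reducedCStar X)))
    (hV : ∀ V, fullOp V ∈ S) (hK : ∀ K : Set X, IsClopen K → proj K ∈ S) : S = ⊤ := by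
  have hmul := mulOp_mem hcl hK
  -- Induction on a finite family of full group elements covering the support. Carriers are clopen,
  -- so `f = f 1_V + (f - f 1_V)` stays within continuous functions of compact support and plays the
  -- role of a partition of unity.
  have hfin : ∀ (t : Finset (FullGroup X)) (f : C_c(Arr X, ℂ)),
      (∀ a, f a ≠ 0 → ∃ V ∈ t, a ∈ V.carrier) → regular f ∈ S := by
    classical
    intro t
    induction t using Finset.induction_on with
    | empty =>
      intro f hf
      rw [regular_eq_zero fun a ↦ ?_]
      · exact zero_mem S
      · by_contra h
        simpa using hf a h
    | insert V t _ ih =>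
      intro f hf
      have hval : ∀ a, (f * charFun V) a = V.carrier.indicator f a := fun a ↦ by
        change f a * V.carrier.indicator 1 a = _
        by_cases ha : a ∈ V.carrier <;> simp [ha]
      have h1 : regular (f * charFun V) ∈ S := by
        obtain ⟨h, hh⟩ := regular_eq_mulOp_mul_fullOp (f := f * charFun V) (V := V) fun a ha ↦ by
          rw [hval] at ha
          exact Set.mem_of_indicator_ne_zero ha
        rw [hh]
        exact mul_mem (hmul h) (hV V)
      have h2 : regular (f - f * charFun V) ∈ S := by
        refine ih _ fun a ha ↦ ?_
        change f a - (f * charFun V) a ≠ 0 at ha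
        rw [hval] at ha
        by_cases haV : a ∈ V.carrier
        · simp [haV] at ha
        · obtain ⟨W, hW, haW⟩ := hf a (by simpa [haV] using ha)
          exact ⟨W, (Finset.mem_insert.1 hW).resolve_left (fun h ↦ haV (h ▸ haW)), haW⟩
      have h3 := add_mem h1 h2
      rwa [← regular_add, add_sub_cancel] at h3
  have hreg : ∀ f : C_c(Arr X, ℂ), regular f ∈ S := by
    intro f
    obtain ⟨t, ht⟩ := f.hasCompactSupport.isCompact.elim_finite_subcover
      (fun V : FullGroup X ↦ V.carrier) (fun V ↦ V.isOpen) fun a _ ↦ by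
        obtain ⟨V, hV⟩ := FullGroup.exists_mem horbit a
        exact Set.mem_iUnion.2 ⟨V, hV⟩
    refine hfin t f fun a ha ↦ ?_
    simpa using ht (subset_tsupport _ ha)
  -- The comparison is made among operators on `ℓ²(G)`, where `reducedCStar X` is by definition the
  -- closure of the algebra generated by the `λ(f)`.
  have hle : reducedCStar X ≤ S.map (reducedCStar X).subtype := by
    refine StarSubalgebra.topologicalClosure_minimal ?_ ?_
    · refine StarAlgebra.adjoin_le ?_
      rintro _ ⟨f, rfl⟩
      exact ⟨regular f, hreg f, rfl⟩
    · have hA : IsClosed (reducedCStar X : Set (L2 X →L[ℂ] L2 X)) := inferInstance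
      exact hA.isClosedEmbedding_subtypeVal.isClosedMap _ hcl
  refine eq_top_iff.2 fun a _ ↦ ?_
  obtain ⟨b, hb, hba⟩ := hle a.2
  rwa [Subtype.ext hba] at hb

end Generation

/-! ### Products of differences `1_V - 1` around a clopen projection -/

section Augmentation

variable {X : Type u} [Groupoid.{v} X] [TopologicalSpace X] [TopologicalSpace (Arr X)] [IsAmple X]
  [CompactSpace X]

theorem fullOp_mem (V : FullGroup X) : fullOp V ∈ repCStar (piR X) :=
  StarSubalgebra.le_topologicalClosure _ (StarAlgebra.subset_adjoin ℂ _ ⟨V, rfl⟩)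

/-- The identity `v_V v_W* = v_V v_V* v_W v_W*`, where `v_V = (1_V - 1) 1_K`, if `K` and its images by
`V` and `W` are disjoint. -/
theorem diffOn_mul_star_mem (V W : FullGroup X) {K : Set X} (hK : IsClopen K)
    (hV : Disjoint K (V.image K)) (hW : Disjoint K (W.image K))
    (hVW : Disjoint (V.image K) (W.image K)) :
    diffOn V K * star (diffOn W K) ∈ repCStar (piR X) := by
  have hVK := V.isClopen_image hK
  have hWK := W.isClopen_image hK
  have h1 : proj K * (fullOp W * proj K) = 0 := by
    rw [fullOp_mul_proj W hK, ← mul_assoc, proj_mul_proj_of_disjoint hK hWK hW, zero_mul]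
  have h2 : (proj K * fullOp V⁻¹) * proj K = 0 := by
    have := congrArg star (fullOp_mul_proj V hK)
    rw [star_mul, star_mul, star_proj, star_proj, star_fullOp] at this
    rw [this, mul_assoc, proj_mul_proj_of_disjoint hVK hK hV.symm, mul_zero]
  have h3 : (proj K * fullOp V⁻¹) * (fullOp W * proj K) = 0 := by
    have := congrArg star (fullOp_mul_proj V hK)
    rw [star_mul, star_mul, star_proj, star_proj, star_fullOp] at this
    rw [this, fullOp_mul_proj W hK, mul_assoc, ← mul_assoc (proj _),
      proj_mul_proj_of_disjoint hVK hWK hVW, zero_mul, mul_zero]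
  -- Of the four terms of the expansion, the three containing `V⁻¹` or `W` vanish by disjointness.
  have h4 : star (diffOn V K) * diffOn W K = proj K := by
    rw [diffOn, diffOn, star_mul, star_sub, star_one, star_proj, star_fullOp, mul_sub, sub_mul,
      mul_one, sub_mul, one_mul, mul_sub, mul_sub, h3, h2, h1, proj_mul_self hK]
    abel
  obtain ⟨V', hV'⟩ := exists_swap V hK hV
  obtain ⟨W', hW'⟩ := exists_swap W hK hW
  -- By `h4` the two inner factors on the right multiply to `proj K`, which the outer factors
  -- absorb.
  have h5 : diffOn V K * star (diffOn W K) = (1 - fullOp V') * (1 - fullOp W') := by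
    rw [hV', hW', mul_assoc, ← mul_assoc (star (diffOn V K)), h4, diffOn, mul_assoc, mul_assoc,
      ← mul_assoc (proj K) (proj K), proj_mul_self hK]
  rw [h5]
  exact mul_mem (sub_mem (one_mem _) (fullOp_mem _)) (sub_mem (one_mem _) (fullOp_mem _))

/-- The scalar `2` is invertible, so a factor `v_T* v_T` may be inserted between `v_V` and `v_W*`.
-/
theorem star_diffOn_mul_self (V : FullGroup X) {K : Set X} (hK : IsClopen K)
    (hV : Disjoint K (V.image K)) : star (diffOn V K) * diffOn V K = (2 : ℂ) • proj K := by
  have hVK := V.isClopen_image hK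
  have h1 : proj K * (fullOp V * proj K) = 0 := by
    rw [fullOp_mul_proj V hK, ← mul_assoc, proj_mul_proj_of_disjoint hK hVK hV, zero_mul]
  have h2 : (proj K * fullOp V⁻¹) * proj K = 0 := by
    have := congrArg star h1
    rwa [star_mul, star_mul, star_proj, star_fullOp, star_zero] at this
  have h3 : (proj K * fullOp V⁻¹) * (fullOp V * proj K) = proj K := by
    rw [mul_assoc, ← mul_assoc (fullOp V⁻¹), fullOp_inv_mul, one_mul, proj_mul_self hK]
  rw [diffOn, star_mul, star_sub, star_one, star_proj, star_fullOp, mul_sub, sub_mul,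
    mul_one, sub_mul, one_mul, mul_sub, mul_sub, h3, h2, h1, proj_mul_self hK, two_smul]
  abel

/-- The elements `(1_V - 1) 1_L (1_W - 1)*` belong to the C*-algebra generated by the full group, for
all clopen subsets `L` of a neighbourhood of `x`. -/
def GoodAt (x : X) (V W : FullGroup X) : Prop :=
  ∃ K, IsClopen K ∧ x ∈ K ∧ ∀ L, IsClopen L → L ⊆ K →
    diffOn V L * star (diffOn W L) ∈ repCStar (piR X)

/-- As `x`, `y`, `z` are distinct, a small clopen neighbourhood of `x` and its two images are
pairwise disjoint, and so are those of its subsets. -/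
theorem GoodAt.of_ne_of_ne {V W : FullGroup X} {x y z : X} {g : x ⟶ y} {h : x ⟶ z}
    (hg : (⟨x, y, g⟩ : Arr X) ∈ V.carrier) (hh : (⟨x, z, h⟩ : Arr X) ∈ W.carrier)
    (hxy : x ≠ y) (hxz : x ≠ z) (hyz : y ≠ z) : GoodAt x V W := by
  obtain ⟨K₁, hK₁, hx₁, hd₁⟩ := V.exists_disjoint_image hg hxy
  obtain ⟨K₂, hK₂, hx₂, hd₂⟩ := W.exists_disjoint_image hh hxz
  obtain ⟨K₃, hK₃, hx₃, hd₃⟩ := V.exists_disjoint_image_image W hg hh hyz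
  refine ⟨K₁ ∩ K₂ ∩ K₃, (hK₁.inter hK₂).inter hK₃, ⟨⟨hx₁, hx₂⟩, hx₃⟩, fun L hL hLK ↦ ?_⟩
  have h1 : L ⊆ K₁ := fun a ha ↦ (hLK ha).1.1
  have h2 : L ⊆ K₂ := fun a ha ↦ (hLK ha).1.2
  have h3 : L ⊆ K₃ := fun a ha ↦ (hLK ha).2
  exact diffOn_mul_star_mem V W hL (hd₁.mono h1 (V.image_mono h1)) (hd₂.mono h2 (W.image_mono h2))
    (hd₃.mono (V.image_mono h3) (W.image_mono h3))

/-- If `V` and `W` send `x` to the same point `y`, one goes through `T` sending `x` to a third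
point: `v_V v_T* v_T v_W*` is twice `v_V v_W*`. -/
theorem GoodAt.of_ne (horbit : ∀ x : X, 3 ≤ (orbit x).encard) {V W : FullGroup X} {x y z : X}
    {g : x ⟶ y} {h : x ⟶ z} (hg : (⟨x, y, g⟩ : Arr X) ∈ V.carrier)
    (hh : (⟨x, z, h⟩ : Arr X) ∈ W.carrier) (hxy : x ≠ y) (hxz : x ≠ z) : GoodAt x V W := by
  obtain rfl | hyz := eq_or_ne y z
  · obtain ⟨w, hwx, hwy, ⟨k⟩⟩ := exists_hom_notMem_pair horbit x y
    obtain ⟨T, hT⟩ := FullGroup.exists_mem horbit ⟨x, w, k⟩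
    obtain ⟨K₁, hK₁, hx₁, hd₁⟩ := GoodAt.of_ne_of_ne hg hT hxy hwx.symm hwy.symm
    obtain ⟨K₂, hK₂, hx₂, hd₂⟩ := GoodAt.of_ne_of_ne hT hh hwx.symm hxz hwy
    obtain ⟨K₃, hK₃, hx₃, hd₃⟩ := T.exists_disjoint_image hT hwx.symm
    refine ⟨K₁ ∩ K₂ ∩ K₃, (hK₁.inter hK₂).inter hK₃, ⟨⟨hx₁, hx₂⟩, hx₃⟩, fun L hL hLK ↦ ?_⟩
    have h1 : L ⊆ K₁ := fun a ha ↦ (hLK ha).1.1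
    have h2 : L ⊆ K₂ := fun a ha ↦ (hLK ha).1.2
    have h3 : L ⊆ K₃ := fun a ha ↦ (hLK ha).2
    have h4 := mul_mem (hd₁ L hL h1) (hd₂ L hL h2)
    have h5 : diffOn V L * star (diffOn T L) * (diffOn T L * star (diffOn W L))
        = (2 : ℂ) • (diffOn V L * star (diffOn W L)) := by
      rw [mul_assoc, ← mul_assoc (star (diffOn T L)),
        star_diffOn_mul_self T hL (hd₃.mono h3 (T.image_mono h3)), smul_mul_assoc, mul_smul_comm,
        diffOn, diffOn, star_mul, star_proj, mul_assoc, ← mul_assoc (proj L) (proj L),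
        proj_mul_self hL, mul_assoc (fullOp V - 1)]
    rw [h5] at h4
    have h6 := SMulMemClass.smul_mem (2⁻¹ : ℂ) h4
    rwa [smul_smul, inv_mul_cancel₀ two_ne_zero, one_smul] at h6
  · exact GoodAt.of_ne_of_ne hg hh hxy hxz hyz

theorem GoodAt.symm {V W : FullGroup X} {x : X} (h : GoodAt x V W) : GoodAt x W V := by
  obtain ⟨K, hK, hxK, hKm⟩ := h
  refine ⟨K, hK, hxK, fun L hL hLK ↦ ?_⟩
  have := star_mem (hKm L hL hLK)
  rwa [star_mul, star_star] at this

/-- The cocycle identity `v - 1 = t (t⁻¹ v - 1) + (t - 1)`. If `V` fixes `x`, it replaces `V` by two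
elements that move `x`, at the cost of a factor from the full group. -/
theorem diffOn_eq_mul_add (V T : FullGroup X) (K : Set X) :
    diffOn V K = fullOp T * diffOn (T⁻¹ * V) K + diffOn T K := by
  have h : fullOp T * (fullOp T⁻¹ * fullOp V) = fullOp V := by
    rw [← mul_assoc, fullOp_mul_inv, one_mul]
  rw [diffOn, diffOn, diffOn, ← mul_assoc, mul_sub, fullOp_mul, h, mul_one, ← add_mul,
    sub_add_sub_cancel]

theorem GoodAt.of_ne_left (horbit : ∀ x : X, 3 ≤ (orbit x).encard) (V : FullGroup X)
    {W : FullGroup X} {x z : X} {h : x ⟶ z} (hh : (⟨x, z, h⟩ : Arr X) ∈ W.carrier)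
    (hxz : x ≠ z) : GoodAt x V W := by
  obtain ⟨y, g, hg⟩ := V.exists_src x
  obtain rfl | hxy := eq_or_ne x y
  · obtain ⟨w, hwx, -, ⟨k⟩⟩ := exists_hom_notMem_pair horbit x x
    obtain ⟨S, hS⟩ := FullGroup.exists_mem horbit ⟨x, w, k⟩
    -- The identity is applied with `T = S⁻¹`. Here `T⁻¹ V = S V` moves `x` to `w`, and `T` moves
    -- `x` to `w'`, which differs from `x` because `S` does not fix `x`.
    obtain ⟨w', k', hk'⟩ := S.exists_rng x
    have hSi : (⟨x, w', inv k'⟩ : Arr X) ∈ S⁻¹.carrier := ⟨_, hk', rfl⟩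
    have hxw' : x ≠ w' := by
      rintro rfl
      exact hwx (congrArg rng (S.eq_of_src hS hk'))
    have hSV : (⟨x, w, g ≫ k⟩ : Arr X) ∈ (S⁻¹⁻¹ * V).carrier := by
      rw [inv_inv]
      exact mul_mem_setMul hS hg
    obtain ⟨K₁, hK₁, hx₁, hm₁⟩ := GoodAt.of_ne horbit hSV hh hwx.symm hxz
    obtain ⟨K₂, hK₂, hx₂, hm₂⟩ := GoodAt.of_ne horbit hSi hh hxw' hxz
    refine ⟨K₁ ∩ K₂, hK₁.inter hK₂, ⟨hx₁, hx₂⟩, fun L hL hLK ↦ ?_⟩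
    rw [diffOn_eq_mul_add V S⁻¹, add_mul, mul_assoc]
    exact add_mem (mul_mem (fullOp_mem _) (hm₁ L hL fun a ha ↦ (hLK ha).1))
      (hm₂ L hL fun a ha ↦ (hLK ha).2)
  · exact GoodAt.of_ne horbit hg hh hxy hxz

/-- The reduction made in `GoodAt.of_ne_left` for the first factor is repeated for the second,
through adjoints. -/
theorem GoodAt.all (horbit : ∀ x : X, 3 ≤ (orbit x).encard) (V W : FullGroup X) (x : X) :
    GoodAt x V W := by
  obtain ⟨w, hwx, -, ⟨k⟩⟩ := exists_hom_notMem_pair horbit x x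
  obtain ⟨S, hS⟩ := FullGroup.exists_mem horbit ⟨x, w, k⟩
  obtain ⟨w', k', hk'⟩ := S.exists_rng x
  have hSi : (⟨x, w', inv k'⟩ : Arr X) ∈ S⁻¹.carrier := ⟨_, hk', rfl⟩
  have hxw' : x ≠ w' := by
    rintro rfl
    exact hwx (congrArg rng (S.eq_of_src hS hk'))
  obtain ⟨y, g, hg⟩ := W.exists_src x
  obtain rfl | hxy := eq_or_ne x y
  · have hSW : (⟨x, w, g ≫ k⟩ : Arr X) ∈ (S⁻¹⁻¹ * W).carrier := by
      rw [inv_inv]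
      exact mul_mem_setMul hS hg
    obtain ⟨K₁, hK₁, hx₁, hm₁⟩ := (GoodAt.of_ne_left horbit V hSW hwx.symm)
    obtain ⟨K₂, hK₂, hx₂, hm₂⟩ := (GoodAt.of_ne_left horbit V hSi hxw')
    refine ⟨K₁ ∩ K₂, hK₁.inter hK₂, ⟨hx₁, hx₂⟩, fun L hL hLK ↦ ?_⟩
    rw [diffOn_eq_mul_add W S⁻¹, star_add, star_mul, mul_add, ← mul_assoc]
    exact add_mem (mul_mem (hm₁ L hL fun a ha ↦ (hLK ha).1) (star_mem (fullOp_mem _)))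
      (hm₂ L hL fun a ha ↦ (hLK ha).2)
  · exact GoodAt.of_ne_left horbit V hg hxy

/-- `(1_V - 1) 1_K (1_W - 1)*` belongs to the C*-algebra generated by the full group. -/
theorem sub_one_mul_proj_mul_mem (horbit : ∀ x : X, 3 ≤ (orbit x).encard) (V W : FullGroup X)
    {K : Set X} (hK : IsClopen K) :
    (fullOp V - 1) * proj K * star (fullOp W - 1) ∈ repCStar (piR X) := by
  refine isClopen_induction (P := fun K ↦
    (fullOp V - 1) * proj K * star (fullOp W - 1) ∈ repCStar (piR X)) ?_ ?_ ?_ hK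
  · rw [proj_empty, mul_zero, zero_mul]
    exact zero_mem _
  · intro K L hK hL hd h1 h2
    rw [proj_union hK hL hd, mul_add, add_mul]
    exact add_mem h1 h2
  · intro x
    obtain ⟨K, hK, hxK, hm⟩ := GoodAt.all horbit V W x
    refine ⟨K, hK, hxK, fun L hL hLK ↦ ?_⟩
    have := hm L hL hLK
    rwa [diffOn, diffOn, star_mul, star_proj, mul_assoc, ← mul_assoc (proj L) (proj L),
      proj_mul_self hL, ← mul_assoc] at this

end Augmentation

/-! ### Limits of vector states and asymptotic eigenvectors -/

section LimState

open Filter Topology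
open scoped InnerProductSpace

variable {H : Type*} [NormedAddCommGroup H] [InnerProductSpace ℂ H] {ι : Type*}

/-- By compactness of closed balls of `ℂ`, bounded families converge along an ultrafilter, so
`limUnder` is a genuine limit. -/
theorem tendsto_ultrafilter_limUnder (l : Ultrafilter ι) {f : ι → ℂ} {C : ℝ} (hf : ∀ i, ‖f i‖ ≤ C) :
    Tendsto f l (𝓝 (limUnder l f)) := by
  refine tendsto_nhds_limUnder ?_
  obtain ⟨c, -, hc⟩ := (isCompact_closedBall (0 : ℂ) C).ultrafilter_le_nhds (l.map f)
    (le_principal_iff.2 (Filter.mem_map.2 (Filter.univ_mem' fun i ↦ by simpa using hf i)))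
  exact ⟨c, hc⟩

theorem norm_inner_apply_le {ξ : H} (hξ : ‖ξ‖ = 1) (T : H →L[ℂ] H) : ‖⟪ξ, T ξ⟫_ℂ‖ ≤ ‖T‖ := by
  refine (norm_inner_le_norm _ _).trans ?_
  rw [hξ, one_mul]
  simpa [hξ] using T.le_opNorm ξ

/-- The limit along an ultrafilter of the vector states given by unit vectors `ξ i`. -/
noncomputable def limState (l : Ultrafilter ι) (ξ : ι → H) (hξ : ∀ i, ‖ξ i‖ = 1) :
    (H →L[ℂ] H) →L[ℂ] ℂ :=
  have key (T : H →L[ℂ] H) := tendsto_ultrafilter_limUnder l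
    (f := fun i ↦ ⟪ξ i, T (ξ i)⟫_ℂ) fun i ↦ norm_inner_apply_le (hξ i) T
  LinearMap.mkContinuous
    { toFun := fun T ↦ limUnder l fun i ↦ ⟪ξ i, T (ξ i)⟫_ℂ
      map_add' := fun S T ↦ tendsto_nhds_unique (key (S + T)) (by
        simpa [inner_add_right] using (key S).add (key T))
      map_smul' := fun c T ↦ tendsto_nhds_unique (key (c • T)) (by
        simpa [inner_smul_right] using (key T).const_mul c) }
    1 fun T ↦ by
      rw [one_mul]
      exact le_of_tendsto (key T).norm
        (Eventually.of_forall fun i ↦ norm_inner_apply_le (hξ i) T)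

variable (l : Ultrafilter ι) {ξ : ι → H} (hξ : ∀ i, ‖ξ i‖ = 1)

theorem tendsto_limState (T : H →L[ℂ] H) :
    Tendsto (fun i ↦ ⟪ξ i, T (ξ i)⟫_ℂ) l (𝓝 (limState l ξ hξ T)) :=
  tendsto_ultrafilter_limUnder l fun i ↦ norm_inner_apply_le (hξ i) T

theorem limState_one : limState l ξ hξ 1 = 1 :=
  tendsto_nhds_unique (tendsto_limState l hξ 1) (by simp [hξ, inner_self_eq_norm_sq_to_K])

theorem norm_limState_le (T : H →L[ℂ] H) : ‖limState l ξ hξ T‖ ≤ ‖T‖ :=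
  le_of_tendsto (tendsto_limState l hξ T).norm
    (Eventually.of_forall fun i ↦ norm_inner_apply_le (hξ i) T)

theorem limState_nonneg {T : H →L[ℂ] H} (hT : ∀ η : H, 0 ≤ ⟪η, T η⟫_ℂ) : 0 ≤ limState l ξ hξ T :=
  ge_of_tendsto (tendsto_limState l hξ T) (Eventually.of_forall fun _ ↦ hT _)

theorem limState_star [CompleteSpace H] (T : H →L[ℂ] H) :
    limState l ξ hξ (star T) = star (limState l ξ hξ T) := by
  refine tendsto_nhds_unique (tendsto_limState l hξ _) ?_
  refine ((tendsto_limState l hξ T).star).congr fun i ↦ ?_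
  rw [ContinuousLinearMap.star_eq_adjoint, ContinuousLinearMap.adjoint_inner_right]
  exact inner_conj_symm _ _

/-- If the vectors `ξ i` are asymptotic eigenvectors of `S` with eigenvalue `c`, then the limit state of
`T S` is `c` times the limit state of `T`. -/
theorem limState_mul {S : H →L[ℂ] H} {c : ℂ} (hS : Tendsto (fun i ↦ S (ξ i) - c • ξ i) l (𝓝 0))
    (T : H →L[ℂ] H) : limState l ξ hξ (T * S) = limState l ξ hξ T * c := by
  refine tendsto_nhds_unique (tendsto_limState l hξ _) ?_
  have h1 : Tendsto (fun i ↦ ⟪ξ i, T (S (ξ i) - c • ξ i)⟫_ℂ) l (𝓝 0) := by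
    have h2 : Tendsto (fun i ↦ T (S (ξ i) - c • ξ i)) l (𝓝 0) := by
      have := (T.continuous.tendsto 0).comp hS
      rwa [map_zero] at this
    refine squeeze_zero_norm (fun i ↦ ?_) (tendsto_zero_iff_norm_tendsto_zero.1 h2)
    have := norm_inner_le_norm (𝕜 := ℂ) (ξ i) (T (S (ξ i) - c • ξ i))
    rwa [hξ, one_mul] at this
  have h3 := ((tendsto_limState l hξ T).mul_const c).add h1
  rw [add_zero] at h3
  refine h3.congr fun i ↦ ?_
  simp only [map_sub, map_smul, inner_sub_right, inner_smul_right, mul_apply_eq_comp]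
  ring

/-- The right factor is absorbed by `limState_mul` with eigenvalue `1`, and the left one in the same
way after taking adjoints. -/
theorem limState_conj [CompleteSpace H] {S : H →L[ℂ] H}
    (hS : Tendsto (fun i ↦ S (ξ i) - ξ i) l (𝓝 0)) (T : H →L[ℂ] H) :
    limState l ξ hξ (star S * T * S) = limState l ξ hξ T := by
  have h1 : Tendsto (fun i ↦ S (ξ i) - (1 : ℂ) • ξ i) l (𝓝 0) := by simpa using hS
  rw [limState_mul l hξ h1, mul_one, ← star_star (star S * T), limState_star, star_mul, star_star,
    limState_mul l hξ h1, mul_one, limState_star, star_star]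

/-- The operators for which the vectors `ξ i` are asymptotic eigenvectors, with eigenvalue given by the
limit state, form a closed set. -/
theorem isClosed_setOf_tendsto_eigenvector :
    IsClosed {T : H →L[ℂ] H | Tendsto (fun i ↦ T (ξ i) - limState l ξ hξ T • ξ i) l (𝓝 0)} := by
  refine isClosed_of_closure_subset fun T hT ↦ ?_
  rw [Set.mem_ofPred_eq, NormedAddGroup.tendsto_nhds_zero]
  intro ε hε
  -- Passing from `S` to `T` costs `‖T - S‖` twice, once for the vector and once for the eigenvalue.
  -- The total is at most three terms below `ε / 4`.
  obtain ⟨S, hS, hTS⟩ := Metric.mem_closure_iff.1 hT (ε / 4) (by positivity)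
  rw [Set.mem_ofPred_eq, NormedAddGroup.tendsto_nhds_zero] at hS
  filter_upwards [hS (ε / 4) (by positivity)] with i hi
  rw [dist_eq_norm] at hTS
  have h1 : ‖(T - S) (ξ i)‖ ≤ ‖T - S‖ := by simpa [hξ] using (T - S).le_opNorm (ξ i)
  have h2 : ‖limState l ξ hξ (T - S) • ξ i‖ ≤ ‖T - S‖ := by
    rw [norm_smul, hξ, mul_one]
    exact norm_limState_le l hξ _
  have h3 : T (ξ i) - limState l ξ hξ T • ξ i = (T - S) (ξ i)
      - limState l ξ hξ (T - S) • ξ i + (S (ξ i) - limState l ξ hξ S • ξ i) := by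
    rw [map_sub, sub_smul, sub_apply]
    abel
  rw [h3]
  refine (norm_add_le _ _).trans_lt ?_
  have := norm_sub_le ((T - S) (ξ i)) (limState l ξ hξ (T - S) • ξ i)
  linarith

theorem limState_eq_of_tendsto {T : H →L[ℂ] H} {c : ℂ}
    (hT : Tendsto (fun i ↦ T (ξ i) - c • ξ i) l (𝓝 0)) : limState l ξ hξ T = c := by
  simpa [limState_one] using limState_mul l hξ hT 1

/-- The closed star subalgebra of the operators for which the `ξ i` are asymptotic eigenvectors, and
whose adjoint has the same property. -/
noncomputable def eigenSubalgebra [CompleteSpace H] : StarSubalgebra ℂ (H →L[ℂ] H) :=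
  let P (T : H →L[ℂ] H) : Prop := Tendsto (fun i ↦ T (ξ i) - limState l ξ hξ T • ξ i) l (𝓝 0)
  -- An asymptotic eigenvalue is necessarily the limit state, so membership can be checked with any
  -- candidate `c`.
  have hP {T : H →L[ℂ] H} {c : ℂ} (h : Tendsto (fun i ↦ T (ξ i) - c • ξ i) l (𝓝 0)) : P T := by
    change Tendsto (fun i ↦ T (ξ i) - limState l ξ hξ T • ξ i) l (𝓝 0)
    rwa [limState_eq_of_tendsto l hξ h]
  have hadd {S T : H →L[ℂ] H} (hS : P S) (hT : P T) : P (S + T) := by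
    refine hP (c := limState l ξ hξ S + limState l ξ hξ T) ?_
    have := hS.add hT
    rw [add_zero] at this
    refine this.congr fun i ↦ ?_
    rw [add_smul, add_apply]
    abel
  have hmul {S T : H →L[ℂ] H} (hS : P S) (hT : P T) : P (S * T) := by
    refine hP (c := limState l ξ hξ T * limState l ξ hξ S) ?_
    -- With `a`, `b` the eigenvalues of `S`, `T`: `S T ξ - b a ξ = S (T ξ - b ξ) + b (S ξ - a ξ)`.
    have h1 := ((S.continuous.tendsto 0).comp hT).add (hS.const_smul (limState l ξ hξ T))
    rw [map_zero, smul_zero, add_zero] at h1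
    refine h1.congr fun i ↦ ?_
    simp only [Function.comp_apply, map_sub, map_smul, smul_sub, smul_smul,
      mul_apply_eq_comp]
    abel
  have halg (c : ℂ) : P (algebraMap ℂ _ c) := by
    refine hP (c := c) ?_
    simp [Algebra.algebraMap_eq_smul_one]
  { carrier := {T | P T ∧ P (star T)}
    mul_mem' := fun {S T} hS hT ↦ ⟨hmul hS.1 hT.1, by rw [star_mul]; exact hmul hT.2 hS.2⟩
    add_mem' := fun {S T} hS hT ↦ ⟨hadd hS.1 hT.1, by rw [star_add]; exact hadd hS.2 hT.2⟩
    algebraMap_mem' := fun c ↦ ⟨halg c, by rw [← algebraMap_star_comm]; exact halg _⟩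
    star_mem' := fun {S} hS ↦ ⟨hS.2, by rw [star_star]; exact hS.1⟩ }

theorem isClosed_eigenSubalgebra [CompleteSpace H] :
    IsClosed (eigenSubalgebra l hξ : Set (H →L[ℂ] H)) :=
  (isClosed_setOf_tendsto_eigenvector l hξ).inter
    ((isClosed_setOf_tendsto_eigenvector l hξ).preimage continuous_star)

theorem limState_mul_of_mem [CompleteSpace H] (S : H →L[ℂ] H) {T : H →L[ℂ] H}
    (hT : T ∈ eigenSubalgebra l hξ) :
    limState l ξ hξ (S * T) = limState l ξ hξ S * limState l ξ hξ T :=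
  limState_mul l hξ hT.1 S

end LimState

/-! ### Almost invariant vectors and characters -/

section AlmostInvariant

open Filter Topology

variable (X : Type u) [Groupoid.{v} X] [TopologicalSpace X] [TopologicalSpace (Arr X)] [IsAmple X]
  [CompactSpace X]

/-- The left regular representation of the full group has almost invariant vectors. -/
def HasAlmostInvariantVectors : Prop :=
  ∀ (F : Finset (FullGroup X)) (ε : ℝ), 0 < ε →
    ∃ ξ : L2 X, ‖ξ‖ = 1 ∧ ∀ V ∈ F, ‖(fullOp V).1 ξ - ξ‖ < ε

variable {X}

theorem norm_fullOp_apply (V : FullGroup X) (ξ : L2 X) : ‖(fullOp V).1 ξ‖ = ‖ξ‖ := by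
  refine le_antisymm (norm_leftRegular_charFun_le V ξ) ?_
  have h := norm_leftRegular_charFun_le V⁻¹ ((fullOp V).1 ξ)
  have h1 : leftRegular (charFun V⁻¹) ((fullOp V).1 ξ) = ξ := by
    change (fullOp V⁻¹ * fullOp V).1 ξ = ξ
    rw [fullOp_inv_mul]
    rfl
  rwa [h1] at h

theorem HasAlmostInvariantVectors.exists_ultrafilter (h : HasAlmostInvariantVectors X) :
    ∃ (ι : Type max u v) (l : Ultrafilter ι) (ξ : ι → L2 X), (∀ i, ‖ξ i‖ = 1) ∧
      ∀ V, Tendsto (fun i ↦ (fullOp V).1 (ξ i) - ξ i) l (𝓝 0) := by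
  classical
  -- The index `(F, n)` carries a unit vector moved by less than `1 / (n + 1)` by each element of
  -- `F`.
  choose ξ hξ hξV using fun i : Finset (FullGroup X) × ℕ ↦
    h i.1 (1 / ((i.2 : ℝ) + 1)) Nat.one_div_pos_of_nat
  refine ⟨_, Ultrafilter.of atTop, ξ, hξ, fun V ↦ ?_⟩
  refine Tendsto.mono_left ?_ (Ultrafilter.of_le atTop)
  have h0 : Tendsto (fun i : Finset (FullGroup X) × ℕ ↦ 1 / ((i.2 : ℝ) + 1)) atTop (𝓝 0) := by
    rw [← prod_atTop_atTop_eq]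
    exact tendsto_one_div_add_atTop_nhds_zero_nat.comp tendsto_snd
  refine squeeze_zero_norm' ?_ h0
  filter_upwards [eventually_ge_atTop (({V}, 0) : Finset (FullGroup X) × ℕ)] with i hi
  exact (hξV i V (hi.1 (Finset.mem_singleton_self V))).le

/-- Almost invariant vectors yield a character of the C*-algebra generated by the full group. -/
theorem HasAlmostInvariantVectors.hasCharacter (h : HasAlmostInvariantVectors X) :
    HasCharacter (repCStar (piR X)) := by
  obtain ⟨ι, l, ξ, hξ, hinv⟩ := h.exists_ultrafilter
  have hle : repCStar (piR X) ≤ (eigenSubalgebra l hξ).comap (reducedCStar X).subtype := by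
    refine StarSubalgebra.topologicalClosure_minimal (StarAlgebra.adjoin_le ?_)
      ((isClosed_eigenSubalgebra l hξ).preimage continuous_subtype_val)
    -- Every element of the full group has asymptotic eigenvalue `1`; its adjoint is `V⁻¹`, to which
    -- the same applies.
    have key (V : FullGroup X) :
        Tendsto (fun i ↦ (fullOp V).1 (ξ i) - limState l ξ hξ (fullOp V).1 • ξ i) l (𝓝 0) := by
      have h1 : Tendsto (fun i ↦ (fullOp V).1 (ξ i) - (1 : ℂ) • ξ i) l (𝓝 0) := by
        simpa using hinv V
      rwa [limState_eq_of_tendsto l hξ h1]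
    rintro _ ⟨V, rfl⟩
    refine ⟨key V, ?_⟩
    have := congrArg Subtype.val (star_fullOp V)
    change star (fullOp V).1 = (fullOp V⁻¹).1 at this
    change Tendsto (fun i ↦ (star (fullOp V).1) (ξ i) - limState l ξ hξ (star (fullOp V).1) • ξ i)
      l (𝓝 0)
    rw [this]
    exact key V⁻¹
  refine ⟨WeakDual.CharacterSpace.equivAlgHom.symm (AlgHom.ofLinearMap
    { toFun := fun b : repCStar (piR X) ↦ limState l ξ hξ b.1.1
      map_add' := fun a b ↦ map_add (limState l ξ hξ) a.1.1 b.1.1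
      map_smul' := fun c a ↦ map_smul (limState l ξ hξ) c a.1.1 } ?_ ?_)⟩
  · exact limState_one l hξ
  · exact fun a b ↦ limState_mul_of_mem l hξ a.1.1 (hle b.2)

end AlmostInvariant

/-! ### Almost invariant vectors and weak containment of the trivial representation -/

section WeakContainment

variable {X : Type u} [Groupoid.{v} X] [TopologicalSpace X] [TopologicalSpace (Arr X)] [IsAmple X]
  [CompactSpace X]

theorem HasAlmostInvariantVectors.weaklyContains (h : HasAlmostInvariantVectors X) :
    WeaklyContains (piR X) (trivialRep (FullGroup X)) := by
  intro α
  change ‖α.sum fun _ c ↦ c • (1 : ℂ)‖ ≤ ‖α.sum fun V c ↦ c • fullOp V‖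
  set S : reducedCStar X := α.sum fun V c ↦ c • fullOp V with hS
  set C : ℝ := ∑ V ∈ α.support, ‖α V‖ with hC
  have hC0 : 0 ≤ C := Finset.sum_nonneg fun _ _ ↦ norm_nonneg _
  refine le_of_forall_pos_le_add fun ε hε ↦ ?_
  -- The total error is at most `C` times this tolerance; the `+ 1` avoids division by zero when `α
  -- = 0`.
  obtain ⟨ξ, hξ, hinv⟩ := h α.support (ε / (C + 1)) (by positivity)
  have hSξ : S.1 ξ = ∑ V ∈ α.support, α V • (fullOp V).1 ξ := by
    have : S.1 = ∑ V ∈ α.support, α V • (fullOp V).1 := by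
      rw [hS, Finsupp.sum]
      exact map_sum (reducedCStar X).subtype _ _
    rw [this, sum_apply]
    rfl
  have h1 : (α.sum fun _ c ↦ c • (1 : ℂ)) • ξ
      = S.1 ξ - ∑ V ∈ α.support, α V • ((fullOp V).1 ξ - ξ) := by
    rw [hSξ, ← Finset.sum_sub_distrib, Finsupp.sum, Finset.sum_smul]
    refine Finset.sum_congr rfl fun V _ ↦ ?_
    rw [← smul_sub, sub_sub_cancel, smul_eq_mul, mul_one]
  have h2 : ‖S.1 ξ‖ ≤ ‖S‖ := by
    have := S.1.le_opNorm ξ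
    rwa [hξ, mul_one] at this
  have h3 : ‖∑ V ∈ α.support, α V • ((fullOp V).1 ξ - ξ)‖ ≤ C * (ε / (C + 1)) := by
    refine (norm_sum_le _ _).trans ?_
    rw [hC, Finset.sum_mul]
    refine Finset.sum_le_sum fun V hV ↦ ?_
    rw [norm_smul]
    exact mul_le_mul_of_nonneg_left (hinv V hV).le (norm_nonneg _)
  have h4 : C * (ε / (C + 1)) ≤ ε := by
    rw [mul_div_assoc', div_le_iff₀ (by positivity)]
    nlinarith
  calc ‖α.sum fun _ c ↦ c • (1 : ℂ)‖ = ‖(α.sum fun _ c ↦ c • (1 : ℂ)) • ξ‖ := by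
        rw [norm_smul, hξ, mul_one]
    _ ≤ ‖S.1 ξ‖ + ‖∑ V ∈ α.support, α V • ((fullOp V).1 ξ - ξ)‖ := by
        rw [h1]
        exact norm_sub_le _ _
    _ ≤ ‖S‖ + ε := add_le_add h2 (h3.trans h4)

/-- Weak containment makes the norm of `1 + ∑ V` as large as the number of its terms. A unit vector
almost attaining it is almost fixed by each `V`, because the sum of unit vectors `ξ` and `V ξ` has
norm close to `2`. -/
theorem HasAlmostInvariantVectors.of_weaklyContains
    (h : WeaklyContains (piR X) (trivialRep (FullGroup X))) : HasAlmostInvariantVectors X := by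
  classical
  intro F ε hε
  set S : reducedCStar X := 1 + ∑ V ∈ F, fullOp V with hS
  have hnorm : (F.card : ℝ) + 1 ≤ ‖S‖ := by
    have h1 := h (Finsupp.single 1 1 + ∑ V ∈ F, Finsupp.single V 1)
    change ‖Finsupp.sum _ fun _ c ↦ c • (1 : ℂ)‖ ≤ ‖Finsupp.sum _ fun V c ↦ c • fullOp V‖ at h1
    rw [← Finsupp.linearCombination_apply, ← Finsupp.linearCombination_apply, map_add, map_add,
      map_sum, map_sum] at h1
    simp only [Finsupp.linearCombination_single, one_smul, fullOp_one] at h1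
    rw [← hS] at h1
    refine le_trans (le_of_eq ?_) h1
    rw [Finset.sum_const, nsmul_eq_mul, mul_one, add_comm]
    norm_cast
  -- The bound `1 / 2` makes `F.card + 1 - δ` and `2 - δ` positive. The other one gives `4 - (2 -
  -- δ)² < 4 δ ≤ ε²` in the parallelogram law.
  set δ : ℝ := min (1 / 2) (ε ^ 2 / 4) with hδ
  have hδ0 : 0 < δ := lt_min (by norm_num) (by positivity)
  have hδ1 : δ ≤ 1 / 2 := min_le_left _ _
  have hδ2 : δ ≤ ε ^ 2 / 4 := min_le_right _ _
  obtain ⟨η, hη1, hη⟩ := S.1.exists_lt_apply_of_lt_opNorm (r := F.card + 1 - δ) (by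
    change _ < ‖S‖
    linarith)
  have hcard : (0 : ℝ) ≤ F.card := Nat.cast_nonneg _
  have hη0 : 0 < ‖η‖ := by
    refine norm_pos_iff.2 fun h0 ↦ ?_
    rw [h0, map_zero, norm_zero] at hη
    linarith
  set ξ : L2 X := ((‖η‖⁻¹ : ℝ) : ℂ) • η with hξdef
  have hc : ‖((‖η‖⁻¹ : ℝ) : ℂ)‖ = ‖η‖⁻¹ := by
    rw [Complex.norm_real, norm_inv, norm_norm]
  have hξ : ‖ξ‖ = 1 := by
    rw [hξdef, norm_smul, hc, inv_mul_cancel₀ hη0.ne']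
  have hSξ : F.card + 1 - δ < ‖S.1 ξ‖ := by
    rw [hξdef, map_smul, norm_smul, hc]
    refine hη.trans_le ?_
    exact le_mul_of_one_le_left (norm_nonneg _) ((one_le_inv₀ hη0).2 hη1.le)
  refine ⟨ξ, hξ, fun V hV ↦ ?_⟩
  have hSξ' : S.1 ξ = (ξ + (fullOp V).1 ξ) + ∑ W ∈ F.erase V, (fullOp W).1 ξ := by
    have h1 : S.1 = 1 + ∑ W ∈ F, (fullOp W).1 := by
      rw [hS]
      exact congrArg (1 + ·) (map_sum (reducedCStar X).subtype _ _)
    rw [h1, add_apply, sum_apply, ← Finset.add_sum_erase F _ hV,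
      add_assoc]
    rfl
  have h2 : ‖∑ W ∈ F.erase V, (fullOp W).1 ξ‖ ≤ F.card - 1 := by
    refine (norm_sum_le _ _).trans ?_
    simp only [norm_fullOp_apply, hξ, Finset.sum_const, nsmul_eq_mul, mul_one]
    rw [Finset.card_erase_of_mem hV, Nat.cast_sub (Finset.card_pos.2 ⟨V, hV⟩), Nat.cast_one]
  have h3 : 2 - δ < ‖ξ + (fullOp V).1 ξ‖ := by
    have := norm_add_le (ξ + (fullOp V).1 ξ) (∑ W ∈ F.erase V, (fullOp W).1 ξ)
    rw [← hSξ'] at this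
    linarith
  have h4 := parallelogram_law_with_norm ℂ ((fullOp V).1 ξ) ξ
  rw [norm_fullOp_apply, hξ, add_comm ((fullOp V).1 ξ)] at h4
  refine lt_of_pow_lt_pow_left₀ 2 hε.le ?_
  nlinarith

end WeakContainment

/-- Spectral permanence: the inverse of an element of a closed star subalgebra stays in it. -/
theorem exists_inverse_mem {A : Type*} [CStarAlgebra A] {S : StarSubalgebra ℂ A}
    [IsClosed (S : Set A)] {a : A} (ha : a ∈ S) (hu : IsUnit a) :
    ∃ t ∈ S, t * a = 1 ∧ a * t = 1 := by
  obtain ⟨T, hT⟩ : IsUnit (⟨a, ha⟩ : S) := (StarSubalgebra.coe_isUnit S).1 hu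
  refine ⟨(↑T⁻¹ : S), (↑T⁻¹ : S).2, ?_, ?_⟩
  · have := congrArg Subtype.val T.inv_mul
    rwa [hT] at this
  · have := congrArg Subtype.val T.mul_inv
    rwa [hT] at this

/-! ### Invertibility of a Laplacian, and condition (iv) -/

section SpectralGap

open scoped InnerProductSpace

variable {X : Type u} [Groupoid.{v} X] [TopologicalSpace X] [TopologicalSpace (Arr X)] [IsAmple X]
  [CompactSpace X]

/-- The Laplace operator of a finite subset of the full group. -/
noncomputable def laplacian (F : Finset (FullGroup X)) : reducedCStar X :=
  ∑ V ∈ F, star (fullOp V - 1) * (fullOp V - 1)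

theorem laplacian_mem (F : Finset (FullGroup X)) : laplacian F ∈ repCStar (piR X) :=
  sum_mem fun _ _ ↦ mul_mem (star_mem (sub_mem (fullOp_mem _) (one_mem _)))
    (sub_mem (fullOp_mem _) (one_mem _))

theorem inner_laplacian (F : Finset (FullGroup X)) (ξ : L2 X) :
    ⟪(laplacian F).1 ξ, ξ⟫_ℂ = ((∑ V ∈ F, ‖(fullOp V).1 ξ - ξ‖ ^ 2 : ℝ) : ℂ) := by
  have h1 : (laplacian F).1 = ∑ V ∈ F, star (fullOp V - 1).1 * (fullOp V - 1).1 :=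
    map_sum (reducedCStar X).subtype _ _
  rw [h1, sum_apply, sum_inner, Complex.ofReal_sum]
  refine Finset.sum_congr rfl fun V _ ↦ ?_
  rw [mul_apply_eq_comp, ContinuousLinearMap.star_eq_adjoint,
    ContinuousLinearMap.adjoint_inner_left, inner_self_eq_norm_sq_to_K]
  norm_cast

/-- Without almost invariant vectors, some `F` and `ε` satisfy `∑ ‖V ξ - ξ‖² ≥ ε² ‖ξ‖²` for all `ξ`,
so the Laplacian is coercive. -/
theorem exists_isUnit_laplacian (h : ¬ HasAlmostInvariantVectors X) :
    ∃ F : Finset (FullGroup X), IsUnit (laplacian F).1 := by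
  unfold HasAlmostInvariantVectors at h
  push Not at h
  obtain ⟨F, ε, hε, h⟩ := h
  refine ⟨F, ContinuousLinearMap.isUnit_of_forall_le_norm_inner_map _ (c := ⟨ε ^ 2, by positivity⟩)
    (by change 0 < ε ^ 2; positivity) fun ξ ↦ ?_⟩
  rw [inner_laplacian, Complex.norm_real, Real.norm_of_nonneg (Finset.sum_nonneg fun _ _ ↦
    by positivity)]
  change ‖ξ‖ ^ 2 * ε ^ 2 ≤ _
  by_cases hξ : ξ = 0
  · rw [hξ, norm_zero, zero_pow two_ne_zero, zero_mul]
    exact Finset.sum_nonneg fun _ _ ↦ by positivity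
  have hξ0 : 0 < ‖ξ‖ := norm_pos_iff.2 hξ
  have hc : ‖((‖ξ‖⁻¹ : ℝ) : ℂ)‖ = ‖ξ‖⁻¹ := by
    rw [Complex.norm_real, norm_inv, norm_norm]
  obtain ⟨V, hV, hεV⟩ := h (((‖ξ‖⁻¹ : ℝ) : ℂ) • ξ) (by
    rw [norm_smul, hc, inv_mul_cancel₀ hξ0.ne'])
  rw [map_smul, ← smul_sub, norm_smul, hc, inv_mul_eq_div, le_div_iff₀ hξ0] at hεV
  refine le_trans ?_ (Finset.single_le_sum (f := fun V ↦ ‖(fullOp V).1 ξ - ξ‖ ^ 2)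
    (fun _ _ ↦ by positivity) hV)
  rw [← mul_pow, mul_comm]
  exact pow_le_pow_left₀ (by positivity) hεV 2

/-- Each term of the double sum is `(v - 1)*` times `(v - 1) p_K (w - 1)*` times `w - 1`. -/
theorem laplacian_mul_proj_mul_mem (horbit : ∀ x : X, 3 ≤ (orbit x).encard)
    (F : Finset (FullGroup X)) {K : Set X} (hK : IsClopen K) :
    laplacian F * proj K * laplacian F ∈ repCStar (piR X) := by
  rw [laplacian, Finset.sum_mul, Finset.sum_mul]
  refine sum_mem fun V _ ↦ ?_
  rw [Finset.mul_sum]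
  refine sum_mem fun W _ ↦ ?_
  have h1 := mul_mem (mul_mem (star_mem (sub_mem (fullOp_mem V) (one_mem _)))
    (sub_one_mul_proj_mul_mem horbit V W hK)) (sub_mem (fullOp_mem W) (one_mem _))
  simpa only [mul_assoc] using h1

theorem repCStar_eq_top (horbit : ∀ x : X, 3 ≤ (orbit x).encard)
    (h : ¬ HasAlmostInvariantVectors X) : repCStar (piR X) = ⊤ := by
  obtain ⟨F, hF⟩ := exists_isUnit_laplacian h
  -- The inverse descends twice: from all operators to the reduced C*-algebra, then to the algebra
  -- of the full group.
  obtain ⟨t, htm, h1, h2⟩ := exists_inverse_mem (S := repCStar (piR X)) (laplacian_mem F)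
    ((StarSubalgebra.coe_isUnit (reducedCStar X)).1 hF)
  refine starSubalgebra_eq_top horbit inferInstance fullOp_mem fun K hK ↦ ?_
  have h3 : t * (laplacian F * proj K * laplacian F) * t = proj K := by
    rw [mul_assoc, mul_assoc (laplacian F * proj K), h2, mul_one, ← mul_assoc, h1, one_mul]
  rw [← h3]
  exact mul_mem (mul_mem htm (laplacian_mul_proj_mul_mem horbit F hK)) htm

/-- By covariance and commutativity of `ℂ`, a character takes the same value on `p_K` and
`p_{V(K)}`. If `K` and `V(K)` are disjoint the product is `0`, so both values are `0`. Such sets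
exist around every point, and additivity gives the value `0` at `1`. -/
theorem not_hasCharacter_of_eq_top (horbit : ∀ x : X, 3 ≤ (orbit x).encard)
    (h : repCStar (piR X) = ⊤) : ¬ HasCharacter (repCStar (piR X)) := by
  rintro ⟨φ⟩
  have hmem (a : reducedCStar X) : a ∈ repCStar (piR X) := h ▸ trivial
  let χ (a : reducedCStar X) : ℂ := φ ⟨a, hmem a⟩
  have hmul (a b : reducedCStar X) : χ (a * b) = χ a * χ b :=
    map_mul φ (⟨a, hmem a⟩ : repCStar (piR X)) ⟨b, hmem b⟩
  have hadd (a b : reducedCStar X) : χ (a + b) = χ a + χ b :=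
    map_add φ (⟨a, hmem a⟩ : repCStar (piR X)) ⟨b, hmem b⟩
  have hone : χ 1 = 1 := map_one φ
  have hzero : χ 0 = 0 := map_zero φ
  have huniv : χ (proj (Set.univ : Set X)) = 0 := by
    refine isClopen_induction (P := fun K : Set X ↦ χ (proj K) = 0) ?_ ?_ ?_ isClopen_univ
    · rw [proj_empty, hzero]
    · intro K L hK hL hd h1 h2
      rw [proj_union hK hL hd, hadd, h1, h2, add_zero]
    · intro x
      obtain ⟨y, hyx, -, ⟨g⟩⟩ := exists_hom_notMem_pair horbit x x
      obtain ⟨V, hV⟩ := FullGroup.exists_mem horbit ⟨x, y, g⟩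
      obtain ⟨K, hK, hxK, hd⟩ := V.exists_disjoint_image hV hyx.symm
      refine ⟨K, hK, hxK, fun L hL hLK ↦ ?_⟩
      have h1 : χ (fullOp V) * χ (proj L) = χ (proj (V.image L)) * χ (fullOp V) := by
        rw [← hmul, fullOp_mul_proj V hL, hmul]
      have h2 : χ (fullOp V) * χ (fullOp V⁻¹) = 1 := by rw [← hmul, fullOp_mul_inv, hone]
      have h3 : χ (proj L) * χ (proj (V.image L)) = 0 := by
        rw [← hmul, proj_mul_proj_of_disjoint hL (V.isClopen_image hL)
          (hd.mono hLK (V.image_mono hLK)), hzero]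
      have h4 : χ (fullOp V) ≠ 0 := left_ne_zero_of_mul_eq_one h2
      have h5 : χ (proj L) = χ (proj (V.image L)) :=
        mul_left_cancel₀ h4 (h1.trans (mul_comm _ _))
      rw [← h5] at h3
      exact mul_self_eq_zero.1 h3
  rw [proj_univ, hone] at huniv
  exact one_ne_zero huniv

end SpectralGap

/-! ### The diagonal part of operators on `ℓ²` -/

section Diagonal

open scoped InnerProductSpace

variable {ι : Type*}

open Classical in
/-- The standard basis vectors of `ℓ²`. -/
noncomputable def basisVec (i : ι) : lp (fun _ : ι ↦ ℂ) 2 := lp.single 2 i 1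

theorem norm_basisVec (i : ι) : ‖basisVec i‖ = 1 := by
  classical
  rw [basisVec, lp.norm_single (by norm_num), norm_one]

theorem inner_basisVec (i : ι) (ξ : lp (fun _ : ι ↦ ℂ) 2) : ⟪basisVec i, ξ⟫_ℂ = ξ i := by
  classical
  rw [basisVec, lp.inner_single_left]
  simp

theorem basisVec_self (i : ι) : basisVec i i = 1 := by
  classical
  simp [basisVec]

theorem basisVec_of_ne {i j : ι} (h : j ≠ i) : basisVec i j = 0 := by
  classical
  simp [basisVec, h]

theorem norm_apply_basisVec_le (T : lp (fun _ : ι ↦ ℂ) 2 →L[ℂ] lp (fun _ : ι ↦ ℂ) 2) (i : ι) :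
    ‖T (basisVec i) i‖ ≤ ‖T‖ := by
  rw [← inner_basisVec]
  exact norm_inner_apply_le (norm_basisVec i) T

/-- The diagonal part of an operator on `ℓ²`. -/
noncomputable def diagonalPart (T : lp (fun _ : ι ↦ ℂ) 2 →L[ℂ] lp (fun _ : ι ↦ ℂ) 2) :
    lp (fun _ : ι ↦ ℂ) 2 →L[ℂ] lp (fun _ : ι ↦ ℂ) 2 :=
  have hle (ξ : lp (fun _ : ι ↦ ℂ) 2) (i : ι) :
      ‖T (basisVec i) i * ξ i‖ ≤ ‖(((‖T‖ : ℝ) : ℂ) • ξ) i‖ := by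
    rw [lp.coeFn_smul, Pi.smul_apply, norm_smul, norm_mul, Complex.norm_real, norm_norm]
    exact mul_le_mul_of_nonneg_right (norm_apply_basisVec_le T i) (norm_nonneg _)
  LinearMap.mkContinuous
    { toFun := fun ξ ↦ ⟨fun i ↦ T (basisVec i) i * ξ i,
        (lp.memℓp (((‖T‖ : ℝ) : ℂ) • ξ)).mono' (hle ξ)⟩
      map_add' := fun ξ η ↦ lp.ext (funext fun i ↦ mul_add _ _ _)
      map_smul' := fun c ξ ↦ lp.ext (funext fun i ↦ mul_left_comm _ _ _) }
    ‖T‖ fun ξ ↦ by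
      refine (lp.norm_mono (by norm_num) (hle ξ)).trans_eq ?_
      rw [norm_smul, Complex.norm_real, norm_norm]

variable (S T : lp (fun _ : ι ↦ ℂ) 2 →L[ℂ] lp (fun _ : ι ↦ ℂ) 2)

theorem diagonalPart_apply (ξ : lp (fun _ : ι ↦ ℂ) 2) (i : ι) :
    diagonalPart T ξ i = T (basisVec i) i * ξ i := rfl

theorem norm_diagonalPart_le : ‖diagonalPart T‖ ≤ ‖T‖ := by
  unfold diagonalPart
  exact LinearMap.mkContinuous_norm_le _ (norm_nonneg _) _

theorem diagonalPart_add : diagonalPart (S + T) = diagonalPart S + diagonalPart T :=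
  ContinuousLinearMap.ext fun _ ↦ lp.ext (funext fun _ ↦ add_mul _ _ _)

theorem diagonalPart_smul (c : ℂ) : diagonalPart (c • T) = c • diagonalPart T :=
  ContinuousLinearMap.ext fun _ ↦ lp.ext (funext fun _ ↦ mul_assoc _ _ _)

theorem diagonalPart_one :
    diagonalPart (1 : lp (fun _ : ι ↦ ℂ) 2 →L[ℂ] lp (fun _ : ι ↦ ℂ) 2) = 1 := by
  refine ContinuousLinearMap.ext fun ξ ↦ lp.ext (funext fun i ↦ ?_)
  rw [diagonalPart_apply, one_apply_eq_self, one_apply_eq_self, basisVec_self, one_mul]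

theorem diagonalPart_star : diagonalPart (star T) = star (diagonalPart T) := by
  refine (ContinuousLinearMap.eq_adjoint_iff _ _).2 fun ξ η ↦ ?_
  rw [lp.inner_eq_tsum, lp.inner_eq_tsum]
  refine tsum_congr fun i ↦ ?_
  have h : (star T) (basisVec i) i = star (T (basisVec i) i) := by
    rw [← inner_basisVec, ← inner_basisVec, ContinuousLinearMap.star_eq_adjoint,
      ContinuousLinearMap.adjoint_inner_right]
    exact (inner_conj_symm _ _).symm
  rw [diagonalPart_apply, diagonalPart_apply, h]
  simp only [RCLike.inner_apply, map_mul, RCLike.star_def, Complex.conj_conj]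
  ring

/-- The diagonal entries of `T* T` are the numbers `‖T δ_i‖²`. -/
theorem inner_diagonalPart_star_mul_self_nonneg (ξ : lp (fun _ : ι ↦ ℂ) 2) :
    0 ≤ ⟪ξ, diagonalPart (star T * T) ξ⟫_ℂ := by
  rw [lp.inner_eq_tsum]
  refine tsum_nonneg fun i ↦ ?_
  have h : (star T * T) (basisVec i) i = ((‖T (basisVec i)‖ ^ 2 : ℝ) : ℂ) := by
    rw [← inner_basisVec, mul_apply_eq_comp, ContinuousLinearMap.star_eq_adjoint,
      ContinuousLinearMap.adjoint_inner_right, inner_self_eq_norm_sq_to_K]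
    norm_cast
  rw [diagonalPart_apply, h, RCLike.inner_apply, mul_assoc, RCLike.mul_conj]
  norm_cast
  positivity

end Diagonal

/-! ### Almost invariant vectors and tracial states -/

section Trace

open Filter Topology
open scoped InnerProductSpace

variable {X : Type u} [Groupoid.{v} X] [TopologicalSpace X] [TopologicalSpace (Arr X)] [IsAmple X]
  [CompactSpace X]

theorem proj_basisVec {K : Set X} (hK : IsClopen K) (γ : Arr X) :
    (proj K).1 (basisVec γ) = K.indicator (1 : X → ℂ) (rng γ) • basisVec γ := by
  refine lp.ext (funext fun δ ↦ ?_)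
  rw [proj_apply hK, lp.coeFn_smul, Pi.smul_apply, smul_eq_mul]
  by_cases h : δ = γ
  · rw [h]
  · rw [basisVec_of_ne h, mul_zero, mul_zero]

/-- Basis vectors are eigenvectors of `proj K`. This is why the trace uses the diagonal part: the
limit state alone need not have the clopen projections in its centralizer. -/
theorem diagonalPart_proj_mul {K : Set X} (hK : IsClopen K) (b : reducedCStar X) :
    diagonalPart (proj K * b).1 = diagonalPart (b * proj K).1 := by
  refine ContinuousLinearMap.ext fun ξ ↦ lp.ext (funext fun γ ↦ ?_)
  rw [diagonalPart_apply, diagonalPart_apply, reducedCStar_mul_apply, reducedCStar_mul_apply,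
    proj_apply hK, proj_basisVec hK, map_smul]
  rfl

theorem fullOp_basisVec (V : FullGroup X) {x y z : X} (γ : x ⟶ y) {g : y ⟶ z}
    (hg : (⟨y, z, g⟩ : Arr X) ∈ V.carrier) :
    (fullOp V).1 (basisVec ⟨x, y, γ⟩) = basisVec ⟨x, z, γ ≫ g⟩ := by
  refine lp.ext (funext fun ⟨x', z', δ⟩ ↦ ?_)
  obtain ⟨y', g', hg'⟩ := V.exists_rng z'
  rw [fullOp_apply V _ δ g' hg']
  by_cases h : (⟨x', z', δ⟩ : Arr X) = ⟨x, z, γ ≫ g⟩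
  · simp only [Quiver.Total.mk.injEq] at h
    obtain ⟨rfl, rfl, h⟩ := h
    obtain rfl := eq_of_heq h
    have e := V.eq_of_rng hg' hg
    simp only [Quiver.Total.mk.injEq] at e
    obtain ⟨rfl, -, e⟩ := e
    obtain rfl := eq_of_heq e
    rw [basisVec_self]
    simp [basisVec_self]
  · rw [basisVec_of_ne h]
    refine basisVec_of_ne fun e ↦ h ?_
    simp only [Quiver.Total.mk.injEq] at e
    obtain ⟨rfl, rfl, e⟩ := e
    obtain rfl := eq_of_heq e
    have e := V.eq_of_src hg' hg
    simp only [Quiver.Total.mk.injEq] at e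
    obtain ⟨-, rfl, e⟩ := e
    obtain rfl := eq_of_heq e
    simp

/-- The diagonal part of `b 1_V` is conjugate to the one of `1_V b`. -/
theorem diagonalPart_mul_fullOp (V : FullGroup X) (b : reducedCStar X) :
    diagonalPart (b * fullOp V).1
      = star (fullOp V).1 * diagonalPart (fullOp V * b).1 * (fullOp V).1 := by
  have hstar : star (fullOp V).1 = (fullOp V⁻¹).1 := congrArg Subtype.val (star_fullOp V)
  rw [hstar]
  refine ContinuousLinearMap.ext fun ξ ↦ lp.ext (funext fun ⟨x, y, γ⟩ ↦ ?_)
  obtain ⟨z, g, hg⟩ := V.exists_src y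
  have hgi : (⟨z, y, inv g⟩ : Arr X) ∈ V⁻¹.carrier := ⟨_, hg, rfl⟩
  rw [diagonalPart_apply, mul_apply_eq_comp, mul_apply_eq_comp, fullOp_apply V⁻¹ _ γ (inv g) hgi,
    IsIso.inv_inv, diagonalPart_apply, fullOp_apply V ξ (γ ≫ g) g hg, reducedCStar_mul_apply,
    reducedCStar_mul_apply, fullOp_basisVec V γ hg, fullOp_apply V _ (γ ≫ g) g hg]
  simp

/-- Almost invariant vectors yield a tracial state of the reduced C*-algebra. -/
theorem HasAlmostInvariantVectors.hasTracialState (horbit : ∀ x : X, 3 ≤ (orbit x).encard)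
    (h : HasAlmostInvariantVectors X) : HasTracialState (reducedCStar X) := by
  obtain ⟨ι, l, ξ, hξ, hinv⟩ := h.exists_ultrafilter
  let τ : reducedCStar X →L[ℂ] ℂ := LinearMap.mkContinuous
    { toFun := fun a ↦ limState l ξ hξ (diagonalPart a.1)
      map_add' := fun a b ↦ (congrArg _ (diagonalPart_add a.1 b.1)).trans (map_add _ _ _)
      map_smul' := fun c a ↦ (congrArg _ (diagonalPart_smul a.1 c)).trans (map_smul _ _ _) }
    1 fun a ↦ by
      rw [one_mul]
      exact (norm_limState_le l hξ _).trans (norm_diagonalPart_le a.1)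
  have hτ (a : reducedCStar X) : τ a = limState l ξ hξ (diagonalPart a.1) := rfl
  have hτstar (a : reducedCStar X) : τ (star a) = star (τ a) := by
    rw [hτ, hτ, ← limState_star, ← diagonalPart_star]
    rfl
  -- The centralizer of `τ`. It is a closed star subalgebra, so traciality needs checking only on
  -- the generators: `limState_conj` handles the full group and `diagonalPart_proj_mul` the clopen
  -- projections.
  let S : StarSubalgebra ℂ (reducedCStar X) :=
    { carrier := {a | ∀ b, τ (a * b) = τ (b * a)}
      mul_mem' := fun {a a'} ha ha' b ↦ by
        rw [mul_assoc, ha, mul_assoc, ha', mul_assoc]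
      add_mem' := fun {a a'} ha ha' b ↦ by
        rw [add_mul, mul_add, map_add, map_add, ha, ha']
      algebraMap_mem' := fun c b ↦ by rw [Algebra.commutes]
      star_mem' := fun {a} ha b ↦ by
        rw [← star_star b, ← star_mul, ← star_mul, hτstar, hτstar, ha] }
  have hcl : IsClosed (S : Set (reducedCStar X)) := by
    have : (S : Set (reducedCStar X)) = ⋂ b, {a | τ (a * b) = τ (b * a)} := by
      ext a
      simp only [Set.mem_iInter, Set.mem_ofPred_eq]
      rfl
    rw [this]
    exact isClosed_iInter fun b ↦ isClosed_eq (τ.continuous.comp (continuous_mul_const b))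
      (τ.continuous.comp (continuous_const_mul b))
  have hS : S = ⊤ := by
    refine starSubalgebra_eq_top horbit hcl (fun V b ↦ ?_) fun K hK b ↦ ?_
    · rw [hτ, hτ, diagonalPart_mul_fullOp, limState_conj l hξ (hinv V)]
    · rw [hτ, hτ, diagonalPart_proj_mul hK]
  refine ⟨τ.toLinearMap, fun a ↦ ?_, ?_, fun a b ↦ ?_⟩
  · exact limState_nonneg l hξ (inner_diagonalPart_star_mul_self_nonneg a.1)
  · change limState l ξ hξ (diagonalPart 1) = 1
    rw [diagonalPart_one, limState_one]
  · have ha : a ∈ S := hS ▸ trivial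
    exact ha b

end Trace

end AmpleGroupoid

theorem theorem4p6 {X : Type u} [Groupoid.{v} X] [TopologicalSpace X]
    [TopologicalSpace (AmpleGroupoid.Arr X)] [AmpleGroupoid.IsAmple X] [CompactSpace X]
    (horbit : ∀ x : X, 3 ≤ (AmpleGroupoid.orbit x).encard) :
    (¬ AmpleGroupoid.HasTracialState (AmpleGroupoid.reducedCStar X) →
      ¬ AmpleGroupoid.HasCharacter (AmpleGroupoid.repCStar (AmpleGroupoid.piR X))) ∧
    (¬ AmpleGroupoid.HasCharacter (AmpleGroupoid.repCStar (AmpleGroupoid.piR X)) ↔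
      ¬ AmpleGroupoid.WeaklyContains (AmpleGroupoid.piR X)
        (AmpleGroupoid.trivialRep (AmpleGroupoid.FullGroup X))) ∧
    (¬ AmpleGroupoid.WeaklyContains (AmpleGroupoid.piR X)
        (AmpleGroupoid.trivialRep (AmpleGroupoid.FullGroup X)) ↔
      AmpleGroupoid.repCStar (AmpleGroupoid.piR X) = ⊤) := by
  have h1 : AmpleGroupoid.HasAlmostInvariantVectors X →
      AmpleGroupoid.HasCharacter (AmpleGroupoid.repCStar (AmpleGroupoid.piR X)) :=
    AmpleGroupoid.HasAlmostInvariantVectors.hasCharacter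
  have h2 := AmpleGroupoid.repCStar_eq_top horbit
  have h3 := AmpleGroupoid.not_hasCharacter_of_eq_top horbit
  have h4 : AmpleGroupoid.HasAlmostInvariantVectors X ↔ AmpleGroupoid.WeaklyContains
      (AmpleGroupoid.piR X) (AmpleGroupoid.trivialRep (AmpleGroupoid.FullGroup X)) :=
    ⟨AmpleGroupoid.HasAlmostInvariantVectors.weaklyContains,
      AmpleGroupoid.HasAlmostInvariantVectors.of_weaklyContains⟩
  have h5 : AmpleGroupoid.HasAlmostInvariantVectors X →
      AmpleGroupoid.HasTracialState (AmpleGroupoid.reducedCStar X) :=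
    AmpleGroupoid.HasAlmostInvariantVectors.hasTracialState horbit
  rw [← h4]
  -- For (i) ⇒ (ii): a character excludes (iv), so `h2` forces almost invariant vectors, and these
  -- yield a trace.
  refine ⟨fun h hc ↦ h (h5 ?_), ⟨fun h ↦ mt h1 h, fun h ↦ h3 (h2 h)⟩, ⟨h2, fun h ↦ mt h1 (h3 h)⟩⟩
  by_contra hn
  exact h3 (h2 hn) hc
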